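/- Let $G$ be a finite group with identity element $e$ and let $H$ be a proper non-trivial normal subgroup of $G$. The normal subgroup based power graph $\Gamma_H(G)$ is the simple undirected graph with vertex set $(G\setminus H)\cup\{e\}$ in which two distinct vertices $x$ and $y$ are adjacent if and only if $xH=y^mH$ or $yH=x^nH$ for some integers $m,n$. The genus $\gamma(\Gamma)$ of a finite graph $\Gamma$ is the smallest non-negative integer $g$ such that $\Gamma$ can be embedded (drawn without crossing edges) in the sphere with $g$ handles. Let $\mathbb{Z}_n$ be the cyclic group of order $n$, $S_3$ the symmetric group on three letters, and $D_8$ the dihedral group of order $8$. Then: (i) $\gamma(\Gamma_H(G))=1$ if and only if one of the following holds: (a) $|H|\in\{4,5,6\}$ and $G/H\cong\mathbb{Z}_2$; (b) $|H|=3$ and $G/H\cong\mathbb{Z}_3$ or $G/H\cong S_3$; (c) $|H|=2$ and $G/H$ is isomorphic to one of the groups $\mathbb{Z}_3$, $S_3$, $D_8$, $\mathbb{Z}_4$. (ii) $\gamma(\Gamma_H(G))=2$ if and only if one of the following holds: (a) $|H|=7$ and $G/H\cong\mathbb{Z}_2$; (b) $|H|=2$ and $G/H$ is a $2$-group of exponent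 $4$ which has exactly two cyclic subgroups of order $4$. -/

import Mathlib

namespace SimpleGraph

variable {V : Type*}

/-- A rotation system on a graph: a permutation of the darts (directed edges) which, at every vertex,
cyclically permutes all the darts leaving that vertex. These are the combinatorial descriptions of
the cellular drawings of the graph, without crossings, on closed oriented surfaces: `next d` is the
dart that follows `d` in the positive sense around its initial vertex. -/
structure RotationSystem (Γ : SimpleGraph V) where
  next : Equiv.Perm Γ.Dart
  fst_next : ∀ d : Γ.Dart, (next d).fst = d.fst
  sameCycle_next : ∀ d d' : Γ.Dart, d.fst = d'.fst → next.SameCycle d d'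

namespace RotationSystem

variable {Γ : SimpleGraph V}

/-- Face tracing: after running along the dart `d` from `u` to `v`, continue along the dart that
follows the reversed dart (from `v` to `u`) in the rotation around `v`. -/
def facePerm (R : Γ.RotationSystem) : Equiv.Perm Γ.Dart :=
  (Dart.symm_involutive (G := Γ)).toPerm.trans R.next

/-- The number of faces: one for each orbit of face tracing, and one for each isolated vertex
(which is drawn alone on a sphere, its complement being a single face with no edge on it). -/
noncomputable def numFaces (R : Γ.RotationSystem) : ℕ :=
  Nat.card (Quotient (Equiv.Perm.SameCycle.setoid R.facePerm)) +
    Nat.card {v : V // ∀ w, ¬ Γ.Adj v w}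

/-- The Euler characteristic `|V| - |E| + |F|` of the closed oriented surface obtained by gluing a
disc along every face. It has one component for each connected component of the graph. -/
noncomputable def eulerChar (R : Γ.RotationSystem) : ℤ :=
  (Nat.card V : ℤ) - (Nat.card Γ.edgeSet : ℤ) + (R.numFaces : ℤ)

end RotationSystem

/-- The finite graph `Γ` can be drawn without crossings on the sphere with `g` handles: some rotation
system of `Γ` has a surface whose components have total genus at most `g`. A closed oriented surface
with `c` components of total genus `h` has Euler characteristic `2 * c - 2 * h`; the connected sum of
its components is the sphere with `h` handles, and further handles may be left unused. -/
def EmbedsInSphereWithHandles [Finite V] (Γ : SimpleGraph V) (g : ℕ) : Prop :=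
  ∃ R : Γ.RotationSystem, 2 * (Nat.card Γ.ConnectedComponent : ℤ) - 2 * (g : ℤ) ≤ R.eulerChar

/-- The (orientable) genus of a finite graph: the least `g` such that the graph can be embedded in
the sphere with `g` handles. -/
noncomputable def genus [Finite V] (Γ : SimpleGraph V) : ℕ :=
  sInf {g : ℕ | Γ.EmbedsInSphereWithHandles g}

end SimpleGraph

/-- The normal subgroup based power graph `Γ_H(G)`: its vertex set is `(G ∖ H) ∪ {e}`, and two
distinct vertices `x`, `y` are adjacent iff `xH = y ^ m H` or `yH = x ^ m H` for some integer `m`. -/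
def normalSubgroupPowerGraph {G : Type*} [Group G] (H : Subgroup G) :
    SimpleGraph {x : G // x ∉ H ∨ x = 1} :=
  SimpleGraph.fromRel fun x y =>
    ∃ m : ℤ, (QuotientGroup.mk (x : G) : G ⧸ H) = QuotientGroup.mk ((y : G) ^ m)

/-!
The vertices of `Γ_H(G)` over a set `S` of non-identity cosets, together with `e`, form a block; if no
element of `S` is a power of an element of the complementary set `T` or conversely (the identity
aside), then `Γ_H(G)` consists of the blocks over `S` and over `T`, glued at the vertex `e`. Cosets
that are powers of one another give cliques, with `h = |H|` vertices for each coset and `e` in addition.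

The genus is monotone and additive at a cut vertex. Both are proved for pairs `(σ, τ)` of permutations
of a finite set: `genusDefect σ τ` is `V + E + F - |D| - 2 C`, with `V`, `E`, `F`, `C` the numbers of
orbits of `σ`, `τ`, `σ * τ` and of the group they generate. It equals `-2` times the total genus of a
rotation system when `τ` is the reversal of darts. Multiplying `σ` by a transposition of two elements of
one cycle never increases the genus (`genusDefect_swap_mul`), so that deleting darts does not
(`exists_delete`). At a cut vertex the darts of the two parts may alternate; `exists_separate` splits
the vertex along a face and joins the halves differently until they no longer do.

Suppose the graph embeds in the double torus. The elements `q, q⁻¹, q ^ 2, q ^ (-2)` give a `K₉` when `q`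
has order at least `5`, and `K₉` has genus `3`, so that all elements of the quotient have order at most
`4`. Additivity forbids three copies of `K₅` attached at `e`. Hence there are at most two pairs
`{a, a⁻¹}` of elements of order greater than `2`, and just one when the order is `3`. The groups that
remain (`classification`) are `Z₂`; groups of exponent `2`; cyclic or dihedral groups with rotations of
order `3` or `4`; and groups with exactly two cyclic subgroups of order `4`. In the last case these two
subgroups share their involution, and the graph is, up to triangles attached at `e`, the union of two
`K₇` along a triangle, of genus `2`: the tori triangulated by the two copies are glued along a triangle.
In the other cases the graph is `K₄`, `K₅`, `K₆`, `K₇` or `K₈`, or part of one of them, with planar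
graphs attached at `e`.
-/

/-! ### Cycles of permutations and the genus of a pair of permutations -/

namespace Setoid

variable {D : Type*}

/-- The coarsening of `s` in which the classes of `a` and `b` are made one. -/
def glue (s : Setoid D) (a b : D) : Setoid D where
  r x y := s x y ∨ (s x a ∧ s y b) ∨ (s x b ∧ s y a)
  iseqv :=
    { refl := fun x => Or.inl (s.refl x)
      symm := by
        rintro x y (h | ⟨h, h'⟩ | ⟨h, h'⟩)
        · exact Or.inl (s.symm h)
        · exact Or.inr (Or.inr ⟨h', h⟩)
        · exact Or.inr (Or.inl ⟨h', h⟩)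
      trans := by
        rintro x y z (h | ⟨h, h'⟩ | ⟨h, h'⟩) (k | ⟨k, k'⟩ | ⟨k, k'⟩)
        · exact Or.inl (s.trans h k)
        · exact Or.inr (Or.inl ⟨s.trans h k, k'⟩)
        · exact Or.inr (Or.inr ⟨s.trans h k, k'⟩)
        · exact Or.inr (Or.inl ⟨h, s.trans (s.symm k) h'⟩)
        · exact Or.inr (Or.inl ⟨h, k'⟩)
        · exact Or.inl (s.trans h (s.symm k'))
        · exact Or.inr (Or.inr ⟨h, s.trans (s.symm k) h'⟩)
        · exact Or.inl (s.trans h (s.symm k'))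
        · exact Or.inr (Or.inr ⟨h, k'⟩) }

theorem le_glue (s : Setoid D) (a b : D) : s ≤ s.glue a b := fun _ _ h => Or.inl h

theorem glue_rel (s : Setoid D) (a b : D) : s.glue a b a b := Or.inr (Or.inl ⟨s.refl a, s.refl b⟩)

theorem glue_le_iff {s r : Setoid D} {a b : D} : s.glue a b ≤ r ↔ s ≤ r ∧ r a b := by
  refine ⟨fun h => ⟨(s.le_glue a b).trans h, h (s.glue_rel a b)⟩, ?_⟩
  rintro ⟨h, hab⟩ x y (k | ⟨k, k'⟩ | ⟨k, k'⟩)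
  · exact h k
  · exact r.trans (h k) (r.trans hab (r.symm (h k')))
  · exact r.trans (h k) (r.trans (r.symm hab) (r.symm (h k')))

theorem glue_eq_self {s : Setoid D} {a b : D} (h : s a b) : s.glue a b = s :=
  le_antisymm (glue_le_iff.2 ⟨le_rfl, h⟩) (s.le_glue a b)

theorem card_glue [Finite D] {s : Setoid D} {a b : D} (h : ¬ s a b) :
    Nat.card (Quotient (s.glue a b)) + 1 = Nat.card (Quotient s) := by
  classical
  -- The classes of `s.glue a b` are those of `s` other than the class of `b`.
  let f : {q : Quotient s // q ≠ Quotient.mk s b} → Quotient (s.glue a b) := fun q =>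
    Quotient.map' (s₁ := s) (s₂ := s.glue a b) id (fun _ _ hh => Or.inl hh) q.1
  have hf : Function.Bijective f := by
    constructor
    · rintro ⟨q, hq⟩ ⟨q', hq'⟩ he
      induction q using Quotient.inductionOn with | _ x
      induction q' using Quotient.inductionOn with | _ y
      have hx : ¬ s x b := fun hh => hq (Quotient.sound hh)
      have hy : ¬ s y b := fun hh => hq' (Quotient.sound hh)
      have : s.glue a b x y := Quotient.exact he
      rcases this with k | ⟨_, k⟩ | ⟨k, _⟩
      · exact Subtype.ext (Quotient.sound k)
      · exact absurd k hy
      · exact absurd k hx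
    · intro q
      induction q using Quotient.inductionOn with | _ x
      by_cases hx : s x b
      · refine ⟨⟨Quotient.mk s a, fun hh => h (Quotient.exact hh)⟩, ?_⟩
        exact Quotient.sound (Or.inr (Or.inl ⟨s.refl a, hx⟩))
      · exact ⟨⟨Quotient.mk s x, fun hh => hx (Quotient.exact hh)⟩, rfl⟩
  rw [← Nat.card_congr (Equiv.ofBijective f hf)]
  have : Fintype (Quotient s) := Fintype.ofFinite _
  rw [Nat.card_eq_fintype_card, Nat.card_eq_fintype_card, Fintype.card_subtype_compl]
  simp only [Fintype.card_unique]
  have : 0 < Fintype.card (Quotient s) := Fintype.card_pos_iff.2 ⟨Quotient.mk s b⟩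
  omega

end Setoid

namespace Equiv.Perm

variable {D : Type*}

theorem setoid_rel {π : Perm D} {x y : D} : SameCycle.setoid π x y ↔ π.SameCycle x y := Iff.rfl

theorem setoid_le_iff [Finite D] {π : Perm D} {r : Setoid D} :
    SameCycle.setoid π ≤ r ↔ ∀ x, r x (π x) := by
  refine ⟨fun h x => h ((sameCycle_apply_right).2 (SameCycle.refl _ _)), fun h x y hxy => ?_⟩
  obtain ⟨n, rfl⟩ := SameCycle.exists_nat_pow_eq hxy
  clear hxy
  induction n with
  | zero => exact r.refl _
  | succ n ih => rw [pow_succ', mul_apply]; exact r.trans ih (h _)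

/-- The number of cycles of a permutation, fixed points included. -/
noncomputable def numCycles (π : Perm D) : ℕ := Nat.card (Quotient (SameCycle.setoid π))

/-- The partition into the orbits of the group generated by two permutations. -/
def joinSetoid (σ τ : Perm D) : Setoid D := SameCycle.setoid σ ⊔ SameCycle.setoid τ

/-- The number of orbits of the group generated by two permutations. -/
noncomputable def numOrbits (σ τ : Perm D) : ℕ := Nat.card (Quotient (joinSetoid σ τ))

theorem joinSetoid_le_iff [Finite D] {σ τ : Perm D} {r : Setoid D} :
    joinSetoid σ τ ≤ r ↔ ∀ x, r x (σ x) ∧ r x (τ x) := by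
  rw [joinSetoid, sup_le_iff, setoid_le_iff, setoid_le_iff, forall_and]

theorem joinSetoid_comm (σ τ : Perm D) : joinSetoid σ τ = joinSetoid τ σ := sup_comm _ _

theorem joinSetoid_left (σ τ : Perm D) (x : D) : joinSetoid σ τ x (σ x) :=
  (le_sup_left : SameCycle.setoid σ ≤ joinSetoid σ τ) (sameCycle_apply_right.2 (SameCycle.refl _ _))

theorem joinSetoid_right (σ τ : Perm D) (x : D) : joinSetoid σ τ x (τ x) :=
  (le_sup_right : SameCycle.setoid τ ≤ joinSetoid σ τ) (sameCycle_apply_right.2 (SameCycle.refl _ _))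

theorem setoid_mul_le_joinSetoid [Finite D] (σ τ : Perm D) :
    SameCycle.setoid (σ * τ) ≤ joinSetoid σ τ :=
  setoid_le_iff.2 fun x => (joinSetoid σ τ).trans (joinSetoid_right σ τ x)
    (joinSetoid_left σ τ (τ x))

section Swap

variable [DecidableEq D]

theorem setoid_swap_mul_le_iff [Finite D] {π : Perm D} {a b : D} {r : Setoid D} (hab : r a b) :
    SameCycle.setoid (swap a b * π) ≤ r ↔ SameCycle.setoid π ≤ r := by
  rw [setoid_le_iff, setoid_le_iff]
  have key : ∀ z, r z (swap a b z) := by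
    intro z
    rw [swap_apply_def]
    split_ifs with h h
    · exact h ▸ hab
    · exact h ▸ r.symm hab
    · exact r.refl _
  exact forall_congr' fun x => ⟨fun h => r.trans h (r.symm (key _)), fun h => r.trans h (key _)⟩

theorem glue_setoid_swap_mul [Finite D] (π : Perm D) (a b : D) :
    (SameCycle.setoid (swap a b * π)).glue a b = (SameCycle.setoid π).glue a b := by
  apply eq_of_forall_ge_iff
  intro r
  rw [Setoid.glue_le_iff, Setoid.glue_le_iff]
  exact and_congr_left fun h => setoid_swap_mul_le_iff h

theorem glue_joinSetoid_swap_mul [Finite D] (σ τ : Perm D) (a b : D) :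
    (joinSetoid (swap a b * σ) τ).glue a b = (joinSetoid σ τ).glue a b := by
  apply eq_of_forall_ge_iff
  intro r
  rw [Setoid.glue_le_iff, Setoid.glue_le_iff, joinSetoid, joinSetoid, sup_le_iff, sup_le_iff]
  exact and_congr_left fun h => and_congr_left fun _ => setoid_swap_mul_le_iff h

/-- Up to the first visit to `{a, b}`, the orbit of `a` under `π` is also its orbit under
`swap a b * π`. -/
theorem pow_swap_mul_apply {π : Perm D} {a b : D} {k : ℕ}
    (h : ∀ j, 0 < j → j < k → (π ^ j) a ≠ a ∧ (π ^ j) a ≠ b) :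
    ∀ j < k, ((swap a b * π) ^ j) a = (π ^ j) a := by
  intro j
  induction j with
  | zero => intro _; rfl
  | succ j ih =>
    intro hj
    rw [pow_succ', mul_apply, ih (by omega), mul_apply, ← mul_apply π, ← pow_succ',
      swap_apply_of_ne_of_ne (h _ (by omega) hj).1 (h _ (by omega) hj).2]

theorem sameCycle_swap_mul_iff [Finite D] {π : Perm D} {a b : D} (hab : a ≠ b) :
    (swap a b * π).SameCycle a b ↔ ¬ π.SameCycle a b := by
  classical
  have hex : ∃ k, 0 < k ∧ ((π ^ k) a = a ∨ (π ^ k) a = b) :=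
    ⟨orderOf π, orderOf_pos π, Or.inl (by rw [pow_orderOf_eq_one]; rfl)⟩
  obtain ⟨hk0, hk⟩ := Nat.find_spec hex
  have hmin : ∀ j, 0 < j → j < Nat.find hex → (π ^ j) a ≠ a ∧ (π ^ j) a ≠ b := by
    intro j hj hjk
    have := Nat.find_min hex hjk
    tauto
  set k := Nat.find hex
  have hpow := pow_swap_mul_apply hmin
  have hlast : ((swap a b * π) ^ k) a = swap a b ((π ^ k) a) := by
    obtain ⟨m, hm⟩ : ∃ m, k = m + 1 := ⟨k - 1, by omega⟩
    rw [hm, pow_succ', mul_apply, hpow m (by omega), mul_apply, ← mul_apply π, ← pow_succ']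
  -- A permutation which returns from `a` to `a` without meeting `b` has `a`, `b` in two cycles.
  have aux : ∀ ρ : Perm D, (ρ ^ k) a = a → (∀ j < k, (ρ ^ j) a ≠ b) → ¬ ρ.SameCycle a b := by
    intro ρ hρ hne hs
    obtain ⟨n, hn⟩ := SameCycle.exists_nat_pow_eq hs
    apply hne (n % k) (Nat.mod_lt _ hk0)
    rw [← hn]
    conv_rhs => rw [← Nat.mod_add_div n k, pow_add, mul_apply, pow_mul]
    congr 1
    exact (pow_apply_eq_self_of_apply_eq_self hρ _).symm
  rcases hk with hk | hk
  · rw [hk, swap_apply_left] at hlast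
    refine iff_of_true ⟨k, by simpa using hlast⟩ (aux π hk fun j hj => ?_)
    rcases Nat.eq_zero_or_pos j with rfl | h0
    · exact hab
    · exact (hmin j h0 hj).2
  · rw [hk, swap_apply_right] at hlast
    refine iff_of_false (aux _ hlast fun j hj => ?_) (not_not.2 ⟨k, by simpa using hk⟩)
    rw [hpow j hj]
    rcases Nat.eq_zero_or_pos j with rfl | h0
    · exact hab
    · exact (hmin j h0 hj).2

theorem numCycles_swap_mul_of_not_sameCycle [Finite D] {π : Perm D} {a b : D}
    (h : ¬ π.SameCycle a b) : numCycles (swap a b * π) + 1 = numCycles π := by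
  have hab : a ≠ b := fun hh => h (hh ▸ SameCycle.refl _ _)
  rw [numCycles, numCycles, ← Setoid.card_glue (s := SameCycle.setoid π) h,
    ← glue_setoid_swap_mul, Setoid.glue_eq_self]
  exact (sameCycle_swap_mul_iff hab).2 h

theorem numCycles_swap_mul_of_sameCycle [Finite D] {π : Perm D} {a b : D} (hab : a ≠ b)
    (h : π.SameCycle a b) : numCycles (swap a b * π) = numCycles π + 1 := by
  have := numCycles_swap_mul_of_not_sameCycle (π := swap a b * π) (a := a) (b := b)
    (by rw [sameCycle_swap_mul_iff hab]; exact not_not.2 h)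
  rw [swap_mul_self_mul] at this
  exact this.symm

end Swap

/-- The quantity `V + E + F - |D| - 2 C` of a pair of permutations `σ`, `τ` of the set `D`, where
`V`, `E`, `F`, `C` count the orbits of `σ`, of `τ`, of `σ * τ` and of both together. When `σ` is a
rotation system and `τ` the reversal of darts, it is minus twice the total genus of the surface. -/
noncomputable def genusDefect (σ τ : Perm D) : ℤ :=
  numCycles σ + numCycles τ + numCycles (σ * τ) - Nat.card D - 2 * numOrbits σ τ

theorem numCycles_conj (π ρ : Perm D) : numCycles (ρ * π * ρ⁻¹) = numCycles π := by
  refine Nat.card_congr (Quotient.congr ρ⁻¹ fun x y => ?_)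
  exact sameCycle_conj

theorem genusDefect_comm (σ τ : Perm D) : genusDefect σ τ = genusDefect τ σ := by
  have : numCycles (σ * τ) = numCycles (τ * σ) := by
    rw [← numCycles_conj (τ * σ) σ]; congr 1; group
  rw [genusDefect, genusDefect, this, numOrbits, numOrbits, joinSetoid_comm]
  ring

/-- Splitting a vertex does not increase the genus. -/
theorem genusDefect_swap_mul [Finite D] [DecidableEq D] {σ : Perm D} (τ : Perm D) {a b : D}
    (hab : a ≠ b) (h : σ.SameCycle a b) :
    ∃ k : ℕ, genusDefect (swap a b * σ) τ = genusDefect σ τ + 2 * k := by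
  have hσ := numCycles_swap_mul_of_sameCycle hab h
  have hj : joinSetoid σ τ a b := (le_sup_left : SameCycle.setoid σ ≤ joinSetoid σ τ) h
  have hg : joinSetoid σ τ = (joinSetoid (swap a b * σ) τ).glue a b := by
    rw [glue_joinSetoid_swap_mul, Setoid.glue_eq_self hj]
  by_cases hφ : (σ * τ).SameCycle a b
  · have h2 := numCycles_swap_mul_of_sameCycle hab hφ
    rw [← mul_assoc] at h2
    by_cases hj' : joinSetoid (swap a b * σ) τ a b
    · rw [Setoid.glue_eq_self hj'] at hg
      refine ⟨1, ?_⟩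
      simp only [genusDefect, hσ, h2, numOrbits, hg]
      push_cast; ring
    · have h3 := Setoid.card_glue hj'
      rw [← hg] at h3
      refine ⟨0, ?_⟩
      simp only [genusDefect, hσ, h2, numOrbits, ← h3]
      push_cast; ring
  · have h2 := numCycles_swap_mul_of_not_sameCycle hφ
    have h4 := (sameCycle_swap_mul_iff hab).2 hφ
    rw [← mul_assoc] at h2 h4
    rw [Setoid.glue_eq_self (setoid_mul_le_joinSetoid _ _ h4)] at hg
    refine ⟨0, ?_⟩
    simp only [genusDefect, hσ, ← h2, numOrbits, hg]
    push_cast; ring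

/-- Joining vertices of two components does not change the genus. -/
theorem genusDefect_swap_mul_of_not_joinSetoid [Finite D] [DecidableEq D] {σ τ : Perm D} {a b : D}
    (h : ¬ joinSetoid σ τ a b) : genusDefect (swap a b * σ) τ = genusDefect σ τ := by
  have hσ : ¬ σ.SameCycle a b := fun hh =>
    h ((le_sup_left : SameCycle.setoid σ ≤ joinSetoid σ τ) hh)
  have hφ : ¬ (σ * τ).SameCycle a b := fun hh => h (setoid_mul_le_joinSetoid _ _ hh)
  have hab : a ≠ b := fun hh => hσ (hh ▸ SameCycle.refl _ _)
  have h1 := numCycles_swap_mul_of_not_sameCycle hσ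
  have h2 := numCycles_swap_mul_of_not_sameCycle hφ
  have h3 := Setoid.card_glue h
  rw [← mul_assoc] at h2
  have h4 : joinSetoid (swap a b * σ) τ a b :=
    (le_sup_left : SameCycle.setoid (swap a b * σ) ≤ _) ((sameCycle_swap_mul_iff hab).2 hσ)
  rw [← glue_joinSetoid_swap_mul, Setoid.glue_eq_self h4] at h3
  simp only [genusDefect, ← h1, ← h2, numOrbits, ← h3]
  push_cast; ring

theorem joinSetoid_one_one [Finite D] : joinSetoid (1 : Perm D) 1 = ⊥ := by
  rw [eq_bot_iff, joinSetoid_le_iff]; intro x; exact ⟨rfl, rfl⟩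

theorem genusDefect_one_one [Finite D] : genusDefect (1 : Perm D) 1 = 0 := by
  have h : Nat.card (Quotient (⊥ : Setoid D)) = Nat.card D :=
    (Nat.card_congr (Equiv.ofBijective (Quotient.mk (⊥ : Setoid D))
      ⟨fun _ _ hh => Quotient.exact hh, Quotient.mk_surjective⟩)).symm
  have h' : SameCycle.setoid (1 : Perm D) = ⊥ := by
    rw [eq_bot_iff, setoid_le_iff]; intro x; rfl
  simp only [genusDefect, numCycles, numOrbits, joinSetoid_one_one, mul_one, h', h]
  ring

/-- Removing elements from the cycles of `σ`, keeping the others in place. -/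
theorem exists_delete [Finite D] (σ τ : Perm D) (S : Set D) :
    ∃ σ' : Perm D, (∀ d ∉ S, σ' d = d) ∧
      (∀ a ∈ S, ∀ b ∈ S, σ'.SameCycle a b ↔ σ.SameCycle a b) ∧
      ∃ k : ℕ, genusDefect σ' τ = genusDefect σ τ + 2 * k := by
  classical
  have : Fintype D := Fintype.ofFinite D
  induction hn : σ.support.card using Nat.strong_induction_on generalizing σ with
  | _ n ih =>
    by_cases hS : ∀ d ∉ S, σ d = d
    · exact ⟨σ, hS, fun _ _ _ _ => Iff.rfl, 0, by simp⟩
    push Not at hS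
    obtain ⟨d, hdS, hd⟩ := hS
    have hsd : σ.SameCycle d (σ d) := sameCycle_apply_right.2 (SameCycle.refl _ _)
    obtain ⟨k, hk⟩ := genusDefect_swap_mul τ hd.symm hsd
    obtain ⟨σ', h1, h2, k', hk'⟩ := ih _ (hn ▸ card_support_swap_mul hd) (swap d (σ d) * σ) rfl
    refine ⟨σ', h1, fun a ha b hb => (h2 a ha b hb).trans ?_, k + k', ?_⟩
    · have hfix : (swap d (σ d) * σ) d = d := by simp
      have hg := glue_setoid_swap_mul σ d (σ d)
      rw [Setoid.glue_eq_self (s := SameCycle.setoid σ) hsd] at hg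
      have hne : ∀ x ∈ S, ¬ (swap d (σ d) * σ).SameCycle x d := fun x hx hh =>
        hdS (hh.eq_of_right hfix ▸ hx)
      rw [← setoid_rel, ← setoid_rel, ← hg]
      refine ⟨fun h => Or.inl h, ?_⟩
      rintro (h | ⟨h, _⟩ | ⟨_, h⟩)
      · exact h
      · exact absurd h (hne a ha)
      · exact absurd h (hne b hb)
    · rw [hk', hk]; push_cast; ring

/-- The genus is a natural number, since deleting all the elements only adds even numbers to the defect
and leads to `0`. -/
theorem exists_genusDefect_eq [Finite D] (σ τ : Perm D) : ∃ k : ℕ, genusDefect σ τ = -(2 * k) := by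
  obtain ⟨σ', h1, -, k, hk⟩ := exists_delete σ τ ∅
  obtain ⟨τ', h2, -, l, hl⟩ := exists_delete τ σ' ∅
  obtain rfl : σ' = 1 := Equiv.ext fun d => h1 d (Set.notMem_empty d)
  obtain rfl : τ' = 1 := Equiv.ext fun d => h2 d (Set.notMem_empty d)
  rw [genusDefect_one_one, genusDefect_comm, hk] at hl
  exact ⟨k + l, by push_cast; linarith⟩

end Equiv.Perm

/-! ### Disjoint unions and separation at a vertex -/

namespace Setoid

variable {A B : Type*}

/-- The partition of a disjoint union formed by partitions of the two parts. -/
def sumSetoid (s : Setoid A) (t : Setoid B) : Setoid (A ⊕ B) where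
  r := Sum.LiftRel s t
  iseqv :=
    { refl := by rintro (a | b) <;> constructor <;> apply Setoid.refl
      symm := by rintro _ _ (h | h) <;> constructor <;> exact Setoid.symm h
      trans := by
        rintro _ _ _ (h | h) (k | k)
        · exact Sum.LiftRel.inl (s.trans h k)
        · exact Sum.LiftRel.inr (t.trans h k) }

theorem sumSetoid_le_iff {s : Setoid A} {t : Setoid B} {r : Setoid (A ⊕ B)} :
    sumSetoid s t ≤ r ↔ s ≤ r.comap Sum.inl ∧ t ≤ r.comap Sum.inr := by
  refine ⟨fun h => ⟨fun x y k => h (Sum.LiftRel.inl k), fun x y k => h (Sum.LiftRel.inr k)⟩, ?_⟩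
  rintro ⟨h1, h2⟩ _ _ (k | k)
  · exact h1 k
  · exact h2 k

theorem card_sumSetoid [Finite A] [Finite B] (s : Setoid A) (t : Setoid B) :
    Nat.card (Quotient (sumSetoid s t)) = Nat.card (Quotient s) + Nat.card (Quotient t) := by
  rw [← Nat.card_sum]
  refine Nat.card_congr
    { toFun := Quotient.lift (Sum.map (Quotient.mk s) (Quotient.mk t)) ?_
      invFun := Sum.elim
        (Quotient.map' (s₂ := sumSetoid s t) Sum.inl fun _ _ h => Sum.LiftRel.inl h)
        (Quotient.map' (s₂ := sumSetoid s t) Sum.inr fun _ _ h => Sum.LiftRel.inr h)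
      left_inv := ?_
      right_inv := ?_ }
  · rintro _ _ (h | h)
    · exact congrArg Sum.inl (Quotient.sound h)
    · exact congrArg Sum.inr (Quotient.sound h)
  · intro q
    induction q using Quotient.inductionOn with | _ x
    rcases x with a | b <;> rfl
  · rintro (q | q) <;> induction q using Quotient.inductionOn <;> rfl

end Setoid

namespace Equiv.Perm

section Sum

variable {A B D D' : Type*}

theorem joinSetoid_sumCongr [Finite A] [Finite B] (σ τ : Perm A) (σ' τ' : Perm B) :
    joinSetoid (sumCongr σ σ') (sumCongr τ τ') =
      Setoid.sumSetoid (joinSetoid σ τ) (joinSetoid σ' τ') := by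
  apply eq_of_forall_ge_iff
  intro r
  rw [Setoid.sumSetoid_le_iff, joinSetoid_le_iff, joinSetoid_le_iff, joinSetoid_le_iff, Sum.forall]
  rfl

theorem joinSetoid_self (σ : Perm D) : joinSetoid σ σ = SameCycle.setoid σ := sup_idem _

theorem numOrbits_self (σ : Perm D) : numOrbits σ σ = numCycles σ := by
  rw [numOrbits, joinSetoid_self, numCycles]

theorem numOrbits_sumCongr [Finite A] [Finite B] (σ τ : Perm A) (σ' τ' : Perm B) :
    numOrbits (sumCongr σ σ') (sumCongr τ τ') = numOrbits σ τ + numOrbits σ' τ' := by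
  rw [numOrbits, joinSetoid_sumCongr, Setoid.card_sumSetoid, numOrbits, numOrbits]

theorem genusDefect_sumCongr [Finite A] [Finite B] (σ τ : Perm A) (σ' τ' : Perm B) :
    genusDefect (sumCongr σ σ') (sumCongr τ τ') = genusDefect σ τ + genusDefect σ' τ' := by
  have h : ∀ (π : Perm A) (π' : Perm B),
      numCycles (sumCongr π π') = numCycles π + numCycles π' := fun π π' => by
    simp only [← numOrbits_self, numOrbits_sumCongr]
  rw [genusDefect, Equiv.Perm.sumCongr_mul, h, h, h, numOrbits_sumCongr, Nat.card_sum, genusDefect,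
    genusDefect]
  push_cast; ring

theorem numOrbits_congr [Finite D] [Finite D'] (e : D ≃ D') {σ τ : Perm D} {σ' τ' : Perm D'}
    (hσ : ∀ d, e (σ d) = σ' (e d)) (hτ : ∀ d, e (τ d) = τ' (e d)) :
    numOrbits σ τ = numOrbits σ' τ' := by
  have h1 : joinSetoid σ τ ≤ (joinSetoid σ' τ').comap e := joinSetoid_le_iff.2 fun x => by
    change joinSetoid σ' τ' (e x) (e (σ x)) ∧ joinSetoid σ' τ' (e x) (e (τ x))
    rw [hσ, hτ]
    exact ⟨joinSetoid_left _ _ _, joinSetoid_right _ _ _⟩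
  have h2 : joinSetoid σ' τ' ≤ (joinSetoid σ τ).comap e.symm := joinSetoid_le_iff.2 fun x => by
    obtain ⟨y, rfl⟩ := e.surjective x
    change joinSetoid σ τ (e.symm (e y)) (e.symm (σ' (e y))) ∧
      joinSetoid σ τ (e.symm (e y)) (e.symm (τ' (e y)))
    rw [← hσ, ← hτ]
    simp only [Equiv.symm_apply_apply]
    exact ⟨joinSetoid_left _ _ _, joinSetoid_right _ _ _⟩
  refine Nat.card_congr (Quotient.congr e fun x y => ⟨fun h => h1 h, fun h => ?_⟩)
  simpa [Setoid.comap_rel] using h2 h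

theorem genusDefect_congr [Finite D] [Finite D'] (e : D ≃ D') {σ τ : Perm D} {σ' τ' : Perm D'}
    (hσ : ∀ d, e (σ d) = σ' (e d)) (hτ : ∀ d, e (τ d) = τ' (e d)) :
    genusDefect σ τ = genusDefect σ' τ' := by
  have h : ∀ {π : Perm D} {π' : Perm D'}, (∀ d, e (π d) = π' (e d)) →
      numCycles π = numCycles π' := fun hπ => by
    simp only [← numOrbits_self]; exact numOrbits_congr e hπ hπ
  rw [genusDefect, genusDefect, h hσ, h hτ, Nat.card_congr e, numOrbits_congr e hσ hτ,
    h (π := σ * τ) (π' := σ' * τ') fun d => by rw [mul_apply, mul_apply, hσ, hτ]]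

/-- The genus adds up over a decomposition into invariant parts. -/
theorem genusDefect_eq_add [Finite A] [Finite B] [Finite D] (e : A ⊕ B ≃ D) {σ τ : Perm D}
    {σA τA : Perm A} {σB τB : Perm B}
    (hσA : ∀ a, σ (e (Sum.inl a)) = e (Sum.inl (σA a)))
    (hτA : ∀ a, τ (e (Sum.inl a)) = e (Sum.inl (τA a)))
    (hσB : ∀ b, σ (e (Sum.inr b)) = e (Sum.inr (σB b)))
    (hτB : ∀ b, τ (e (Sum.inr b)) = e (Sum.inr (τB b))) :
    genusDefect σ τ = genusDefect σA τA + genusDefect σB τB := by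
  rw [← genusDefect_sumCongr]
  refine (genusDefect_congr e ?_ ?_).symm
  · rintro (a | b)
    · exact (hσA a).symm
    · exact (hσB b).symm
  · rintro (a | b)
    · exact (hτA a).symm
    · exact (hτB b).symm

end Sum

section Rearrange

theorem swap_apply_mem_iff {D : Type*} [DecidableEq D] {X : Set D} {p q : D} (h : p ∈ X ↔ q ∈ X) (d : D) :
    swap p q d ∈ X ↔ d ∈ X := by
  rw [swap_apply_def]
  split_ifs with h1 h2
  · rw [h1, h]
  · rw [h2, h]
  · rfl

variable {D : Type*} [Finite D]

theorem SameCycle.mem_of_forall {π : Perm D} {X : Set D} (hX : ∀ x ∈ X, π x ∈ X) {x y : D}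
    (h : π.SameCycle x y) (hx : x ∈ X) : y ∈ X := by
  obtain ⟨n, rfl⟩ := SameCycle.exists_nat_pow_eq h
  clear h
  induction n with
  | zero => exact hx
  | succ n ih => rw [pow_succ', mul_apply]; exact hX _ ih

theorem SameCycle.exists_exit {π : Perm D} {X : Set D} {x y : D}
    (h : π.SameCycle x y) (hx : x ∈ X) (hy : y ∉ X) : ∃ d ∈ X, π d ∉ X ∧ π.SameCycle x d := by
  by_contra! hc
  have := h.mem_of_forall (X := {d | d ∈ X ∧ π.SameCycle x d}) (fun d hd => ?_)
    ⟨hx, SameCycle.refl _ _⟩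
  · exact hy this.1
  · refine ⟨?_, sameCycle_apply_right.2 hd.2⟩
    by_contra hn
    exact hc d hd.1 hn hd.2

/-- Splitting a vertex along a face and joining the two halves in any other way does not increase
the genus. -/
theorem genusDefect_le_of_split_of_join [DecidableEq D] {σ τ : Perm D} {y x p q : D} (hne : y ≠ x)
    (hσ : σ.SameCycle y x) (hφ : (σ * τ).SameCycle y x)
    (hp : (swap y x * σ).SameCycle p y) (hq : (swap y x * σ).SameCycle q x) :
    SameCycle.setoid (swap p q * (swap y x * σ)) = SameCycle.setoid σ ∧
      genusDefect σ τ ≤ genusDefect (swap p q * (swap y x * σ)) τ := by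
  have hyx : ¬ (swap y x * σ).SameCycle y x := fun h => (sameCycle_swap_mul_iff hne).1 h hσ
  have hpq : ¬ (swap y x * σ).SameCycle p q := fun h => hyx (hp.symm.trans (h.trans hq))
  have hpq' : p ≠ q := fun h => hpq (h ▸ SameCycle.refl _ _)
  have hglue : SameCycle.setoid σ = (SameCycle.setoid (swap y x * σ)).glue y x := by
    rw [glue_setoid_swap_mul, Setoid.glue_eq_self hσ]
  have h1 : SameCycle.setoid (swap p q * (swap y x * σ)) = SameCycle.setoid σ := by
    have hpq'' := (sameCycle_swap_mul_iff hpq').2 hpq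
    rw [← Setoid.glue_eq_self (s := SameCycle.setoid (swap p q * (swap y x * σ))) hpq'',
      glue_setoid_swap_mul, hglue]
    apply eq_of_forall_ge_iff
    intro r
    rw [Setoid.glue_le_iff, Setoid.glue_le_iff]
    refine and_congr_right fun hr => ⟨fun h => ?_, fun h => ?_⟩
    · exact r.trans (r.symm (hr hp)) (r.trans h (hr hq))
    · exact r.trans (hr hp) (r.trans h (r.symm (hr hq)))
  refine ⟨h1, ?_⟩
  have h2 := numCycles_swap_mul_of_sameCycle hne hφ
  have h3 : numCycles (swap y x * σ * τ) ≤ numCycles (swap p q * (swap y x * σ) * τ) + 1 := by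
    rw [mul_assoc (swap p q)]
    by_cases h : (swap y x * σ * τ).SameCycle p q
    · have := numCycles_swap_mul_of_sameCycle hpq' h
      omega
    · exact (numCycles_swap_mul_of_not_sameCycle h).ge
  rw [← mul_assoc] at h2
  have h4 : numCycles (swap p q * (swap y x * σ)) = numCycles σ := by rw [numCycles, h1, numCycles]
  have h5 : numOrbits (swap p q * (swap y x * σ)) τ = numOrbits σ τ := by
    rw [numOrbits, joinSetoid, h1, numOrbits, joinSetoid]
  rw [genusDefect, genusDefect, h4, h5]
  omega

/-- If `X` is invariant under `τ`, and under `σ` except for a single cycle `E` of `σ`, then that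
cycle can be replaced by a cycle on `E ∩ X` and a cycle on `E ∖ X` without increasing the genus. The
cyclic orders on the two parts need not be those induced by `σ`. -/
theorem exists_separate {τ : Perm D} {X E : Set D} (hX : ∀ d, τ d ∈ X ↔ d ∈ X) {σ : Perm D}
    (hE : ∀ d, σ d ∈ E ↔ d ∈ E) (hcyc : ∀ a ∈ E, ∀ b ∈ E, σ.SameCycle a b)
    (hout : ∀ d ∉ E, σ d ∈ X ↔ d ∈ X) :
    ∃ σ' : Perm D, (∀ d ∉ E, σ' d = σ d) ∧ (∀ d, σ' d ∈ X ↔ d ∈ X) ∧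
      (∀ a ∈ E, ∀ b ∈ E, (a ∈ X ↔ b ∈ X) → σ'.SameCycle a b) ∧
      genusDefect σ τ ≤ genusDefect σ' τ := by
  classical
  induction hn : {d | d ∈ E ∧ d ∈ X ∧ σ d ∉ X}.ncard using Nat.strong_induction_on
    generalizing σ with
  | _ n ih =>
    by_cases hsw : ∀ x ∈ E, x ∈ X → σ x ∈ X
    · refine ⟨σ, fun _ _ => rfl, fun d => ?_, fun a ha b hb _ => hcyc a ha b hb, le_rfl⟩
      have hinv : ∀ x ∈ X, σ x ∈ X := fun x hx => by
        by_cases hxE : x ∈ E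
        · exact hsw x hxE hx
        · exact (hout x hxE).2 hx
      refine ⟨fun h => ?_, fun h => hinv d h⟩
      exact SameCycle.mem_of_forall hinv (sameCycle_apply_left.2 (SameCycle.refl σ d)) h
    push Not at hsw
    obtain ⟨x, hxE, hxX, hyX⟩ := hsw
    -- Follow the face from the corner between `x` and `σ x` to where it first returns to `X`.
    have hface : (σ * τ).SameCycle (σ x) (τ⁻¹ x) := by
      rw [show σ x = (σ * τ) (τ⁻¹ x) by simp]
      exact sameCycle_apply_left.2 (SameCycle.refl _ _)
    have hτx : τ⁻¹ x ∈ X := by rw [← hX]; simpa using hxX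
    obtain ⟨d, hdX, hdX', hd⟩ := hface.exists_exit (X := Xᶜ) hyX (fun h => h hτx)
    rw [Set.mem_compl_iff, not_not] at hdX'
    have hy'X : τ d ∉ X := fun h => hdX ((hX d).1 h)
    have hy'E : τ d ∈ E := by
      by_contra h
      exact hy'X ((hout _ h).1 hdX')
    have hφ : (σ * τ).SameCycle (σ x) (σ (τ d)) := by
      rw [← mul_apply σ τ d]; exact sameCycle_apply_right.2 hd
    set y := σ x with hy
    set x' := σ (τ d) with hx'
    rw [mul_apply, ← hx'] at hdX'
    have hyE : y ∈ E := (hE x).2 hxE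
    have hx'E : x' ∈ E := (hE _).2 hy'E
    have hne : y ≠ x' := fun h => hyX (h ▸ hdX')
    have hs := hcyc y hyE x' hx'E
    set σ₁ := swap y x' * σ with hσ₁
    have hE₁ : ∀ a, σ₁ a ∈ E ↔ a ∈ E := fun a => by
      rw [hσ₁, mul_apply, swap_apply_mem_iff (iff_of_true hyE hx'E), hE]
    have hout₁ : ∀ a ∉ E, σ₁ a = σ a := fun a ha => by
      rw [hσ₁, mul_apply, swap_apply_of_ne_of_ne]
      · exact fun h => ha ((hE a).1 (h ▸ hyE))
      · exact fun h => ha ((hE a).1 (h ▸ hx'E))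
    have hcl : ∀ a ∈ E, σ₁.SameCycle a y ∨ σ₁.SameCycle a x' := fun a ha => by
      have h := hcyc a ha y hyE
      rw [← setoid_rel, ← Setoid.glue_eq_self (s := SameCycle.setoid σ) hs,
        ← glue_setoid_swap_mul] at h
      rcases h with h | ⟨h, _⟩ | ⟨h, _⟩
      · exact Or.inl h
      · exact Or.inl h
      · exact Or.inr h
    by_cases hpq : ∃ p q, (p ∈ X ↔ q ∈ X) ∧ σ₁.SameCycle p y ∧ σ₁.SameCycle q x'
    · obtain ⟨p, q, hpqX, hp, hq⟩ := hpq
      obtain ⟨hset, hle⟩ := genusDefect_le_of_split_of_join hne hs hφ hp hq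
      rw [← hσ₁] at hset hle
      have hpE : p ∈ E := hp.symm.mem_of_forall (fun a ha => (hE₁ a).2 ha) hyE
      have hqE : q ∈ E := hq.symm.mem_of_forall (fun a ha => (hE₁ a).2 ha) hx'E
      set σ₂ := swap p q * σ₁ with hσ₂
      have hE₂ : ∀ a, σ₂ a ∈ E ↔ a ∈ E := fun a => by
        rw [hσ₂, mul_apply, swap_apply_mem_iff (iff_of_true hpE hqE), hE₁]
      have hout₂ : ∀ a ∉ E, σ₂ a = σ a := fun a ha => by
        rw [hσ₂, mul_apply, hout₁ a ha, swap_apply_of_ne_of_ne]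
        · exact fun h => ha ((hE a).1 (h ▸ hpE))
        · exact fun h => ha ((hE a).1 (h ▸ hqE))
      have hlt : {a | a ∈ E ∧ a ∈ X ∧ σ₂ a ∉ X}.ncard < n := by
        rw [← hn]
        refine Set.ncard_lt_ncard ⟨fun a ha => ?_, fun h => ?_⟩ (Set.toFinite _)
        · obtain ⟨h1, h2, h3⟩ := ha
          rw [hσ₂, mul_apply, swap_apply_mem_iff hpqX] at h3
          refine ⟨h1, h2, fun h4 => h3 ?_⟩
          have h5 : σ a ≠ x' := fun h => hy'X ((σ.injective h : a = τ d) ▸ h2)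
          have h6 : σ a ≠ y := fun h => hyX (h ▸ h4)
          rw [hσ₁, mul_apply, swap_apply_of_ne_of_ne h6 h5]
          exact h4
        · have := (h (show x ∈ _ from ⟨hxE, hxX, hyX⟩)).2.2
          rw [hσ₂, mul_apply, swap_apply_mem_iff hpqX, hσ₁, mul_apply, ← hy, swap_apply_left]
            at this
          exact this hdX'
      obtain ⟨σ', h1, h2, h3, h4⟩ := ih _ hlt (σ := σ₂) hE₂
        (fun a ha b hb => by rw [← setoid_rel, hset]; exact hcyc a ha b hb)
        (fun a ha => by rw [hout₂ a ha]; exact hout a ha) rfl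
      exact ⟨σ', fun a ha => (h1 a ha).trans (hout₂ a ha), h2, h3, hle.trans h4⟩
    · push Not at hpq
      have hY : ∀ a, σ₁.SameCycle a y → a ∉ X := fun a ha haX =>
        hpq a x' (iff_of_true haX hdX') ha (SameCycle.refl _ _)
      have hX' : ∀ a, σ₁.SameCycle a x' → a ∈ X := fun a ha => by
        by_contra haX
        exact hpq y a (iff_of_false hyX haX) (SameCycle.refl _ _) ha
      refine ⟨σ₁, hout₁, fun a => ?_, fun a ha b hb hab => ?_, ?_⟩
      · by_cases ha : a ∈ E
        · rcases hcl a ha with h | h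
          · exact iff_of_false (hY _ (sameCycle_apply_left.2 h)) (hY _ h)
          · exact iff_of_true (hX' _ (sameCycle_apply_left.2 h)) (hX' _ h)
        · rw [hout₁ a ha]; exact hout a ha
      · rcases hcl a ha with h | h <;> rcases hcl b hb with k | k
        · exact h.trans k.symm
        · exact absurd (hab.2 (hX' b k)) (hY a h)
        · exact absurd (hab.1 (hX' a h)) (hY b k)
        · exact h.trans k.symm
      · obtain ⟨k, hk⟩ := genusDefect_swap_mul τ hne hs
        rw [hσ₁, hk]; omega

end Rearrange

end Equiv.Perm

/-! ### Rotation systems, subgraphs and cut vertices -/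

namespace Equiv.Perm

variable {A D : Type*}

theorem exists_restrict [Finite A] {i : A → D} (hi : Function.Injective i) {σ : Perm D}
    (h : ∀ a, σ (i a) ∈ Set.range i) : ∃ ρ : Perm A, ∀ a, i (ρ a) = σ (i a) := by
  choose f hf using h
  have hinj : Function.Injective f := fun a b hab => hi (σ.injective (by rw [← hf, ← hf, hab]))
  exact ⟨Equiv.ofBijective f (Finite.injective_iff_bijective.1 hinj), hf⟩

theorem sameCycle_restrict_iff [Finite A] [Finite D] {i : A → D} (hi : Function.Injective i)
    {σ : Perm D} {ρ : Perm A} (h : ∀ a, i (ρ a) = σ (i a)) {a b : A} :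
    ρ.SameCycle a b ↔ σ.SameCycle (i a) (i b) := by
  have hpow : ∀ (n : ℕ) a, (σ ^ n) (i a) = i ((ρ ^ n) a) := by
    intro n a
    induction n with
    | zero => rfl
    | succ n ih => rw [pow_succ', mul_apply, ih, ← h, pow_succ', mul_apply]
  constructor
  · intro hs
    obtain ⟨n, rfl⟩ := SameCycle.exists_nat_pow_eq hs
    rw [← hpow]
    exact sameCycle_pow_right.2 (SameCycle.refl _ _)
  · intro hs
    obtain ⟨n, hn⟩ := SameCycle.exists_nat_pow_eq hs
    rw [hpow] at hn
    rw [← hi hn]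
    exact sameCycle_pow_right.2 (SameCycle.refl _ _)

/-- Fixed points common to both permutations do not contribute to the genus. -/
theorem genusDefect_restrict [Finite A] [Finite D] {i : A → D} (hi : Function.Injective i)
    {σ τ : Perm D} {σA τA : Perm A} (hσ : ∀ a, i (σA a) = σ (i a)) (hτ : ∀ a, i (τA a) = τ (i a))
    (hσ' : ∀ d ∉ Set.range i, σ d = d) (hτ' : ∀ d ∉ Set.range i, τ d = d) :
    genusDefect σ τ = genusDefect σA τA := by
  classical
  let e : A ⊕ ↥(Set.range i)ᶜ ≃ D :=
    (Equiv.sumCongr (Equiv.ofInjective i hi) (Equiv.refl _)).trans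
      (Equiv.Set.sumCompl (Set.range i))
  rw [genusDefect_eq_add e (σA := σA) (τA := τA) (σB := 1) (τB := 1), genusDefect_one_one, add_zero]
  · exact fun a => (hσ a).symm
  · exact fun a => (hτ a).symm
  · exact fun b => hσ' _ b.2
  · exact fun b => hτ' _ b.2

end Equiv.Perm

namespace SimpleGraph

open Equiv.Perm

variable {V V' : Type*}

instance finite_dart [Finite V] (Γ : SimpleGraph V) : Finite Γ.Dart :=
  Finite.of_injective (fun d : Γ.Dart => d.toProd) fun _ _ h => Dart.ext _ _ h

/-- The reversal of darts as a permutation. -/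
def dartSymm (Γ : SimpleGraph V) : Equiv.Perm Γ.Dart := (Dart.symm_involutive (G := Γ)).toPerm

@[simp] theorem dartSymm_apply (Γ : SimpleGraph V) (d : Γ.Dart) : Γ.dartSymm d = d.symm := rfl

theorem card_quotient_eq {D X : Type*} {s : Setoid D} (f : D → X) (hf : Function.Surjective f)
    (h : ∀ x y, s x y ↔ f x = f y) : Nat.card (Quotient s) = Nat.card X := by
  refine Nat.card_congr (Equiv.ofBijective (Quotient.lift f fun x y k => (h x y).1 k) ⟨?_, ?_⟩)
  · intro p q
    induction p using Quotient.inductionOn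
    induction q using Quotient.inductionOn
    exact fun k => Quotient.sound ((h _ _).2 k)
  · intro x
    obtain ⟨d, rfl⟩ := hf x
    exact ⟨Quotient.mk s d, rfl⟩

theorem card_dart [Finite V] (Γ : SimpleGraph V) : Nat.card Γ.Dart = 2 * Nat.card Γ.edgeSet := by
  classical
  have := Fintype.ofFinite V
  rw [Nat.card_eq_fintype_card, dart_card_eq_twice_card_edges, Nat.card_eq_fintype_card,
    edgeFinset_card]

theorem numCycles_dartSymm [Finite V] (Γ : SimpleGraph V) :
    numCycles Γ.dartSymm = Nat.card Γ.edgeSet := by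
  refine card_quotient_eq (fun d => (⟨d.edge, d.edge_mem⟩ : Γ.edgeSet)) ?_ fun x y => ?_
  · rintro ⟨e, he⟩
    induction e using Sym2.ind with | _ u v
    exact ⟨⟨(u, v), he⟩, rfl⟩
  · rw [Subtype.mk_eq_mk, dart_edge_eq_iff]
    constructor
    · have : SameCycle.setoid Γ.dartSymm ≤ Setoid.ker Dart.edge :=
        setoid_le_iff.2 fun d => (Setoid.ker_def.2 (Dart.edge_symm d).symm)
      intro h
      exact (dart_edge_eq_iff x y).1 (Setoid.ker_def.1 (this h))
    · rintro (rfl | rfl)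
      · exact SameCycle.refl _ _
      · exact sameCycle_apply_left.2 (SameCycle.refl Γ.dartSymm y)

namespace RotationSystem

variable {Γ : SimpleGraph V}

theorem fst_eq_of_sameCycle [Finite V] (R : Γ.RotationSystem) {d d' : Γ.Dart}
    (h : R.next.SameCycle d d') : d.fst = d'.fst := by
  have : SameCycle.setoid R.next ≤ Setoid.ker (fun d : Γ.Dart => d.fst) :=
    setoid_le_iff.2 fun d => Setoid.ker_def.2 (R.fst_next d).symm
  exact Setoid.ker_def.1 (this h)

theorem card_vertices [Finite V] (R : Γ.RotationSystem) :
    Nat.card V = numCycles R.next + Nat.card {v : V // ∀ w, ¬ Γ.Adj v w} := by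
  classical
  rw [← Nat.card_congr (Equiv.sumCompl fun v : V => ∀ w, ¬ Γ.Adj v w), Nat.card_sum, add_comm]
  congr 1
  symm
  refine card_quotient_eq (fun d => ⟨d.fst, fun h => h _ d.adj⟩) ?_ fun x y => ?_
  · rintro ⟨v, hv⟩
    push Not at hv
    obtain ⟨w, hw⟩ := hv
    exact ⟨⟨(v, w), hw⟩, rfl⟩
  · rw [Subtype.mk_eq_mk]
    exact ⟨R.fst_eq_of_sameCycle, R.sameCycle_next x y⟩

theorem joinSetoid_iff [Finite V] (R : Γ.RotationSystem) (d d' : Γ.Dart) :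
    joinSetoid R.next Γ.dartSymm d d' ↔ Γ.Reachable d.fst d'.fst := by
  constructor
  · have : joinSetoid R.next Γ.dartSymm ≤ Γ.reachableSetoid.comap (fun d : Γ.Dart => d.fst) := by
      refine joinSetoid_le_iff.2 fun x => ⟨?_, ?_⟩
      · change Γ.Reachable x.fst (R.next x).fst
        rw [R.fst_next]
      · exact x.adj.reachable
    exact fun h => this h
  · rintro ⟨p⟩
    have key : ∀ (u v : V) (p : Γ.Walk u v) (d d' : Γ.Dart), d.fst = u → d'.fst = v →
        joinSetoid R.next Γ.dartSymm d d' := by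
      intro u v p
      induction p with
      | nil =>
        intro d d' h h'
        exact (le_sup_left : SameCycle.setoid R.next ≤ _) (R.sameCycle_next _ _ (h.trans h'.symm))
      | @cons u w v huw p ih =>
        intro d d' h h'
        have h1 : joinSetoid R.next Γ.dartSymm d ⟨(u, w), huw⟩ :=
          (le_sup_left : SameCycle.setoid R.next ≤ _) (R.sameCycle_next _ _ h)
        have h2 := joinSetoid_right R.next Γ.dartSymm ⟨(u, w), huw⟩
        exact Setoid.trans' _ h1 (Setoid.trans' _ h2 (ih _ _ rfl h'))
    exact key _ _ p d d' rfl rfl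

theorem card_connectedComponent [Finite V] (R : Γ.RotationSystem) :
    Nat.card Γ.ConnectedComponent =
      numOrbits R.next Γ.dartSymm + Nat.card {v : V // ∀ w, ¬ Γ.Adj v w} := by
  classical
  rw [← Nat.card_congr (Equiv.sumCompl fun c : Γ.ConnectedComponent =>
    ∃ v w, Γ.Adj v w ∧ Γ.connectedComponentMk v = c), Nat.card_sum]
  congr 1
  · symm
    refine card_quotient_eq (fun d => ⟨Γ.connectedComponentMk d.fst, _, _, d.adj, rfl⟩) ?_
      fun x y => ?_
    · rintro ⟨_, v, w, h, rfl⟩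
      exact ⟨⟨(v, w), h⟩, rfl⟩
    · rw [Subtype.mk_eq_mk, ConnectedComponent.eq, R.joinSetoid_iff]
  · symm
    have hiso : ∀ {u v : V}, Γ.Reachable u v → (∀ w, ¬ Γ.Adj u w) → u = v := by
      rintro u v ⟨p⟩ hu
      cases p with
      | nil => rfl
      | cons h _ => exact absurd h (hu _)
    refine Nat.card_congr (Equiv.ofBijective (fun v => ⟨Γ.connectedComponentMk v.1, ?_⟩) ⟨?_, ?_⟩)
    · rintro ⟨v', w, h, hc⟩
      obtain rfl := hiso (ConnectedComponent.eq.1 hc).symm v.2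
      exact v.2 _ h
    · intro v v' h
      exact Subtype.ext (hiso (ConnectedComponent.eq.1 (Subtype.mk_eq_mk.1 h)) v.2)
    · rintro ⟨c, hc⟩
      induction c using ConnectedComponent.ind with | _ v
      exact ⟨⟨v, fun w hw => hc ⟨v, w, hw, rfl⟩⟩, rfl⟩

theorem eulerChar_eq [Finite V] (R : Γ.RotationSystem) :
    R.eulerChar = 2 * Nat.card Γ.ConnectedComponent + genusDefect R.next Γ.dartSymm := by
  have h1 := R.card_vertices
  have h2 := R.card_connectedComponent
  have h3 : R.numFaces = numCycles (R.next * Γ.dartSymm) +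
    Nat.card {v : V // ∀ w, ¬ Γ.Adj v w} := rfl
  rw [eulerChar, genusDefect, h1, h2, h3, card_dart, numCycles_dartSymm]
  push_cast; ring

end RotationSystem

theorem embedsInSphereWithHandles_iff [Finite V] {Γ : SimpleGraph V} {g : ℕ} :
    Γ.EmbedsInSphereWithHandles g ↔
      ∃ R : Γ.RotationSystem, -(2 * (g : ℤ)) ≤ genusDefect R.next Γ.dartSymm := by
  refine exists_congr fun R => ?_
  rw [R.eulerChar_eq]
  constructor <;> intro h <;> linarith

theorem EmbedsInSphereWithHandles.mono [Finite V] {Γ : SimpleGraph V} {g g' : ℕ}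
    (h : Γ.EmbedsInSphereWithHandles g) (hg : g ≤ g') : Γ.EmbedsInSphereWithHandles g' := by
  obtain ⟨R, hR⟩ := h
  refine ⟨R, le_trans ?_ hR⟩
  have : (g : ℤ) ≤ g' := by exact_mod_cast hg
  linarith

/-- The map induced on darts by a map of vertices that preserves adjacency. -/
def dartMap {Γ' : SimpleGraph V'} {Γ : SimpleGraph V} (f : V' → V)
    (hf : ∀ u v, Γ'.Adj u v → Γ.Adj (f u) (f v)) (d : Γ'.Dart) : Γ.Dart :=
  ⟨(f d.fst, f d.snd), hf _ _ d.adj⟩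

section DartMap

variable {Γ' : SimpleGraph V'} {Γ : SimpleGraph V} {f : V' → V}
  {hf : ∀ u v, Γ'.Adj u v → Γ.Adj (f u) (f v)}

theorem dartMap_injective (hinj : Set.InjOn f Γ'.support) :
    Function.Injective (dartMap f hf) := by
  rintro ⟨⟨u, v⟩, h⟩ ⟨⟨u', v'⟩, h'⟩ he
  have h1 := congrArg (fun d : Γ.Dart => d.fst) he
  have h2 := congrArg (fun d : Γ.Dart => d.snd) he
  have hu := hinj ⟨v, h⟩ ⟨v', h'⟩ h1
  have hv := hinj ⟨u, h.symm⟩ ⟨u', h'.symm⟩ h2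
  dsimp only at hu hv
  subst hu hv
  rfl

/-- A permutation of the darts of `Γ` which preserves the darts of a subgraph, and permutes them
cyclically at each vertex, restricts to a rotation system of the subgraph. -/
theorem exists_rotationSystem [Finite V] [Finite V'] (hinj : Set.InjOn f Γ'.support)
    {σ : Equiv.Perm Γ.Dart} (hfst : ∀ d, (σ (dartMap f hf d)).fst = (dartMap f hf d).fst)
    (hrange : ∀ d, σ (dartMap f hf d) ∈ Set.range (dartMap f hf))
    (hcyc : ∀ d d' : Γ'.Dart, d.fst = d'.fst → σ.SameCycle (dartMap f hf d) (dartMap f hf d')) :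
    ∃ R : Γ'.RotationSystem, ∀ d, dartMap f hf (R.next d) = σ (dartMap f hf d) := by
  obtain ⟨ρ, hρ⟩ := exists_restrict (dartMap_injective hinj) hrange
  refine ⟨⟨ρ, fun d => ?_, fun d d' h => ?_⟩, hρ⟩
  · refine hinj ⟨_, (ρ d).adj⟩ ⟨_, d.adj⟩ ?_
    exact (congrArg (fun d : Γ.Dart => d.fst) (hρ d)).trans (hfst d)
  · exact (sameCycle_restrict_iff (dartMap_injective hinj) hρ).2 (hcyc d d' h)

end DartMap

/-- The genus does not increase when passing to a subgraph. Isolated vertices play no role, so that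
the map of vertices has to be injective on the others only. -/
theorem EmbedsInSphereWithHandles.of_injOn [Finite V] [Finite V'] {Γ' : SimpleGraph V'}
    {Γ : SimpleGraph V} {g : ℕ} (h : Γ.EmbedsInSphereWithHandles g) (f : V' → V)
    (hf : ∀ u v, Γ'.Adj u v → Γ.Adj (f u) (f v)) (hinj : Set.InjOn f Γ'.support) :
    Γ'.EmbedsInSphereWithHandles g := by
  rw [embedsInSphereWithHandles_iff] at h ⊢
  obtain ⟨R, hR⟩ := h
  set i := dartMap f hf with hi_def
  have hi : Function.Injective i := dartMap_injective hinj
  obtain ⟨σ, hσ1, hσ2, k, hk⟩ := exists_delete R.next Γ.dartSymm (Set.range i)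
  obtain ⟨τ, hτ1, hτ2, l, hl⟩ := exists_delete Γ.dartSymm σ (Set.range i)
  have hrange : ∀ {π : Equiv.Perm Γ.Dart}, (∀ d ∉ Set.range i, π d = d) →
      ∀ a, π (i a) ∈ Set.range i := by
    intro π hπ a
    by_contra hn
    exact hn ⟨a, (π.injective (hπ _ hn)).symm⟩
  have hfst : ∀ d, (σ (i d)).fst = (i d).fst := fun d =>
    (R.fst_eq_of_sameCycle ((hσ2 _ ⟨d, rfl⟩ _ (hrange hσ1 d)).1
      (sameCycle_apply_right.2 (SameCycle.refl _ _)))).symm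
  obtain ⟨R', hR'⟩ := exists_rotationSystem (hf := hf) hinj hfst (hrange hσ1) fun d d' hd =>
    (hσ2 _ ⟨d, rfl⟩ _ ⟨d', rfl⟩).2 (R.sameCycle_next _ _ (congrArg f hd))
  refine ⟨R', ?_⟩
  have hτ : ∀ d, i (Γ'.dartSymm d) = τ (i d) := by
    intro d
    have hsymm : i (Γ'.dartSymm d) = Γ.dartSymm (i d) := rfl
    have h1 : τ.SameCycle (i d) (i (Γ'.dartSymm d)) := by
      rw [hτ2 _ ⟨_, rfl⟩ _ ⟨_, rfl⟩, hsymm]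
      exact sameCycle_apply_right.2 (SameCycle.refl _ _)
    have h2 : Γ.dartSymm.SameCycle (i d) (τ (i d)) := by
      rw [← hτ2 _ ⟨_, rfl⟩ _ (hrange hτ1 d)]
      exact sameCycle_apply_right.2 (SameCycle.refl _ _)
    have h3 : τ (i d) = i d ∨ τ (i d) = (i d).symm := by
      have : SameCycle.setoid Γ.dartSymm ≤ Setoid.ker Dart.edge :=
        setoid_le_iff.2 fun d => (Setoid.ker_def.2 (Dart.edge_symm d).symm)
      exact (dart_edge_eq_iff _ _).1 (Setoid.ker_def.1 (this h2)).symm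
    rcases h3 with h3 | h3
    · have := h1.eq_of_left h3
      exact absurd (hsymm.symm.trans this.symm) (Dart.symm_ne _)
    · exact hsymm.trans h3.symm
  have hgd := genusDefect_restrict hi hR' hτ hσ1 hτ1
  rw [genusDefect_comm, hl, genusDefect_comm, hk] at hgd
  rw [← hgd]
  have h1 : (0 : ℤ) ≤ k := Int.natCast_nonneg k
  have h2 : (0 : ℤ) ≤ l := Int.natCast_nonneg l
  linarith

section CutVertex

variable {Γ₁ Γ₂ : SimpleGraph V} {e : V}

theorem not_adj_of_adj (hsep : ∀ v u w, Γ₁.Adj v u → Γ₂.Adj v w → v = e) {u v : V}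
    (h : Γ₁.Adj u v) : ¬ Γ₂.Adj u v := fun h' =>
  h.ne ((hsep _ _ _ h h').trans (hsep _ _ _ h.symm h'.symm).symm)

/-- The darts of a union of two graphs without common edges. -/
noncomputable def dartSumEquiv (hsep : ∀ v u w, Γ₁.Adj v u → Γ₂.Adj v w → v = e) :
    Γ₁.Dart ⊕ Γ₂.Dart ≃ (Γ₁ ⊔ Γ₂).Dart :=
  Equiv.ofBijective
    (Sum.elim (dartMap id fun _ _ h => Or.inl h) (dartMap id fun _ _ h => Or.inr h)) <| by
    constructor
    · rintro (a | a) (b | b) h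
      · exact congrArg _ (dartMap_injective (hf := fun _ _ h => Or.inl h) (Set.injOn_id _) h)
      · have := b.adj
        have h1 := congrArg (fun d : (Γ₁ ⊔ Γ₂).Dart => d.toProd) h
        rw [show b.fst = a.fst from congrArg Prod.fst h1.symm,
          show b.snd = a.snd from congrArg Prod.snd h1.symm] at this
        exact absurd this (not_adj_of_adj hsep a.adj)
      · have := a.adj
        have h1 := congrArg (fun d : (Γ₁ ⊔ Γ₂).Dart => d.toProd) h
        rw [show a.fst = b.fst from congrArg Prod.fst h1,
          show a.snd = b.snd from congrArg Prod.snd h1] at this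
        exact absurd this (not_adj_of_adj hsep b.adj)
      · exact congrArg _ (dartMap_injective (hf := fun _ _ h => Or.inr h) (Set.injOn_id _) h)
    · rintro ⟨⟨u, v⟩, h | h⟩
      · exact ⟨Sum.inl ⟨(u, v), h⟩, rfl⟩
      · exact ⟨Sum.inr ⟨(u, v), h⟩, rfl⟩

/-- Two embedded graphs sharing a single vertex can be embedded together on the connected sum. -/
theorem EmbedsInSphereWithHandles.sup [Finite V] {a b : ℕ}
    (h₁ : Γ₁.EmbedsInSphereWithHandles a) (h₂ : Γ₂.EmbedsInSphereWithHandles b)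
    (hsep : ∀ v u w, Γ₁.Adj v u → Γ₂.Adj v w → v = e) :
    (Γ₁ ⊔ Γ₂).EmbedsInSphereWithHandles (a + b) := by
  classical
  rw [embedsInSphereWithHandles_iff] at h₁ h₂ ⊢
  obtain ⟨R₁, hR₁⟩ := h₁
  obtain ⟨R₂, hR₂⟩ := h₂
  set ε := dartSumEquiv hsep with hε
  let σ : Equiv.Perm (Γ₁ ⊔ Γ₂).Dart := ε.permCongr (Equiv.Perm.sumCongr R₁.next R₂.next)
  have hσ1 : ∀ d, σ (ε (Sum.inl d)) = ε (Sum.inl (R₁.next d)) := fun d => by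
    simp [σ, Equiv.permCongr_apply]
  have hσ2 : ∀ d, σ (ε (Sum.inr d)) = ε (Sum.inr (R₂.next d)) := fun d => by
    simp [σ, Equiv.permCongr_apply]
  have hτ1 : ∀ d, (Γ₁ ⊔ Γ₂).dartSymm (ε (Sum.inl d)) = ε (Sum.inl (Γ₁.dartSymm d)) := fun d => rfl
  have hτ2 : ∀ d, (Γ₁ ⊔ Γ₂).dartSymm (ε (Sum.inr d)) = ε (Sum.inr (Γ₂.dartSymm d)) := fun d => rfl
  have hf1 : ∀ d, (ε (Sum.inl d)).fst = d.fst := fun d => rfl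
  have hf2 : ∀ d, (ε (Sum.inr d)).fst = d.fst := fun d => rfl
  have hgd := genusDefect_eq_add ε hσ1 hτ1 hσ2 hτ2
  have hbound : -(2 * ((a + b : ℕ) : ℤ)) ≤ genusDefect σ (Γ₁ ⊔ Γ₂).dartSymm := by
    rw [hgd]; push_cast; linarith
  have hfst : ∀ d, (σ d).fst = d.fst := fun d => by
    obtain ⟨d | d, rfl⟩ := ε.surjective d
    · rw [hσ1, hf1, hf1, R₁.fst_next]
    · rw [hσ2, hf2, hf2, R₂.fst_next]
  have hcyc1 : ∀ d d', d.fst = d'.fst → σ.SameCycle (ε (Sum.inl d)) (ε (Sum.inl d')) :=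
    fun d d' h => (sameCycle_restrict_iff (i := fun d => ε (Sum.inl d))
      (ε.injective.comp Sum.inl_injective) fun d => (hσ1 d).symm).1 (R₁.sameCycle_next d d' h)
  have hcyc2 : ∀ d d', d.fst = d'.fst → σ.SameCycle (ε (Sum.inr d)) (ε (Sum.inr d')) :=
    fun d d' h => (sameCycle_restrict_iff (i := fun d => ε (Sum.inr d))
      (ε.injective.comp Sum.inr_injective) fun d => (hσ2 d).symm).1 (R₂.sameCycle_next d d' h)
  by_cases hab : ∃ (x : Γ₁.Dart) (y : Γ₂.Dart), x.fst = e ∧ y.fst = e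
  · obtain ⟨x, y, hx, hy⟩ := hab
    have hn : ¬ joinSetoid σ (Γ₁ ⊔ Γ₂).dartSymm (ε (Sum.inl x)) (ε (Sum.inr y)) := by
      have : joinSetoid σ (Γ₁ ⊔ Γ₂).dartSymm ≤ Setoid.ker (fun d => (ε.symm d).isLeft) := by
        refine joinSetoid_le_iff.2 fun d => ?_
        obtain ⟨d | d, rfl⟩ := ε.surjective d
        · rw [hσ1, hτ1]; simp [Setoid.ker_def]
        · rw [hσ2, hτ2]; simp [Setoid.ker_def]
      intro h
      simpa [Setoid.ker_def] using this h
    have hn' : ¬ σ.SameCycle (ε (Sum.inl x)) (ε (Sum.inr y)) := fun h =>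
      hn ((le_sup_left : SameCycle.setoid σ ≤ _) h)
    have hne : ε (Sum.inl x) ≠ ε (Sum.inr y) := fun h => hn' (h ▸ SameCycle.refl _ _)
    have hset : SameCycle.setoid (Equiv.swap (ε (Sum.inl x)) (ε (Sum.inr y)) * σ) =
        (SameCycle.setoid σ).glue (ε (Sum.inl x)) (ε (Sum.inr y)) := by
      rw [← glue_setoid_swap_mul, Setoid.glue_eq_self]
      exact (sameCycle_swap_mul_iff hne).2 hn'
    refine ⟨⟨Equiv.swap (ε (Sum.inl x)) (ε (Sum.inr y)) * σ, fun d => ?_, fun d d' h => ?_⟩, ?_⟩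
    · rw [← hfst d, mul_apply]
      have := swap_apply_mem_iff (X := {c | c.fst = (σ d).fst})
        (p := ε (Sum.inl x)) (q := ε (Sum.inr y)) (by
          change (ε (Sum.inl x)).fst = _ ↔ (ε (Sum.inr y)).fst = _
          rw [hf1, hf2, hx, hy]) (σ d)
      exact this.2 rfl
    · rw [← setoid_rel, hset]
      obtain ⟨d | d, rfl⟩ := ε.surjective d <;> obtain ⟨d' | d', rfl⟩ := ε.surjective d'
      · exact Or.inl (hcyc1 _ _ h)
      · have h1 : d.fst = d'.fst := h
        have h2 : d.fst = e := hsep _ _ _ d.adj (h1 ▸ d'.adj)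
        exact Or.inr (Or.inl ⟨hcyc1 _ _ (h2.trans hx.symm), hcyc2 _ _ ((h1 ▸ h2).trans hy.symm)⟩)
      · have h1 : d.fst = d'.fst := h
        have h2 : d'.fst = e := hsep _ _ _ d'.adj (h1 ▸ d.adj)
        exact Or.inr (Or.inr ⟨hcyc2 _ _ ((h1.trans h2).trans hy.symm), hcyc1 _ _ (h2.trans hx.symm)⟩)
      · exact Or.inl (hcyc2 _ _ h)
    · rw [genusDefect_swap_mul_of_not_joinSetoid hn]; exact hbound
  · refine ⟨⟨σ, hfst, fun d d' h => ?_⟩, hbound⟩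
    obtain ⟨d | d, rfl⟩ := ε.surjective d <;> obtain ⟨d' | d', rfl⟩ := ε.surjective d'
    · exact hcyc1 _ _ h
    · have h1 : d.fst = d'.fst := h
      have h2 : d.fst = e := hsep _ _ _ d.adj (h1 ▸ d'.adj)
      exact absurd ⟨d, d', h2, h1 ▸ h2⟩ hab
    · have h1 : d.fst = d'.fst := h
      have h2 : d'.fst = e := hsep _ _ _ d'.adj (h1 ▸ d.adj)
      exact absurd ⟨d', d, h2, h1.trans h2⟩ hab
    · exact hcyc2 _ _ h

/-- The genus is additive at a cut vertex: an embedding of the union of two graphs sharing a single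
vertex yields embeddings of the two graphs of no larger total genus. -/
theorem EmbedsInSphereWithHandles.exists_of_sup [Finite V] {g : ℕ}
    (h : (Γ₁ ⊔ Γ₂).EmbedsInSphereWithHandles g)
    (hsep : ∀ v u w, Γ₁.Adj v u → Γ₂.Adj v w → v = e) :
    ∃ a b : ℕ, a + b ≤ g ∧ Γ₁.EmbedsInSphereWithHandles a ∧ Γ₂.EmbedsInSphereWithHandles b := by
  classical
  rw [embedsInSphereWithHandles_iff] at h
  obtain ⟨R, hR⟩ := h
  have hEσ : ∀ d, R.next d ∈ {d : (Γ₁ ⊔ Γ₂).Dart | d.fst = e} ↔ d ∈ {d | d.fst = e} := fun d => by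
    rw [Set.mem_ofPred_eq, R.fst_next, Set.mem_ofPred_eq]
  obtain ⟨σ, h1, h2, h3, h4⟩ := exists_separate (τ := (Γ₁ ⊔ Γ₂).dartSymm)
    (X := {d | Γ₁.Adj d.fst d.snd}) (E := {d | d.fst = e}) (σ := R.next)
    (fun d => Γ₁.adj_comm _ _) hEσ
    (fun a ha b hb => R.sameCycle_next _ _ (Eq.trans ha (Eq.symm hb)))
    (fun d hd => by
      have hd' : d.fst ≠ e := hd
      have hfst := R.fst_next d
      have hadj := (R.next d).adj
      change Γ₁.Adj (R.next d).fst (R.next d).snd ↔ _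
      rw [hfst] at hadj ⊢
      constructor
      · intro hh
        exact d.adj.resolve_right fun hh' => hd' (hsep _ _ _ hh hh')
      · intro hh
        exact hadj.resolve_right fun hh' => hd' (hsep _ _ _ hh hh'))
  have hfst : ∀ d, (σ d).fst = d.fst := by
    intro d
    by_cases hd : d.fst = e
    · by_contra hne
      have h5 : (σ d).fst ≠ e := fun hh => hne (hh.trans hd.symm)
      obtain ⟨c, hc⟩ := R.next.surjective (σ d)
      have h6 : c.fst ≠ e := fun hh => h5 (hc ▸ (hEσ c).2 hh)
      have h7 : σ c = σ d := (h1 c h6).trans hc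
      exact h6 (σ.injective h7 ▸ hd)
    · rw [h1 d hd, R.fst_next]
  have hcyc : ∀ d d' : (Γ₁ ⊔ Γ₂).Dart, d.fst = d'.fst → d.fst ≠ e → σ.SameCycle d d' := by
    intro d d' hdd hd
    obtain ⟨n, rfl⟩ := SameCycle.exists_nat_pow_eq (R.sameCycle_next d d' hdd)
    clear hdd
    have : ∀ n : ℕ, ((R.next ^ n) d).fst = d.fst ∧ σ.SameCycle d ((R.next ^ n) d) := by
      intro n
      induction n with
      | zero => exact ⟨rfl, SameCycle.refl _ _⟩
      | succ n ih =>
        rw [pow_succ', mul_apply, R.fst_next]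
        refine ⟨ih.1, ?_⟩
        rw [← h1 _ (by rw [Set.mem_ofPred_eq, ih.1]; exact hd)]
        exact sameCycle_apply_right.2 ih.2
    exact (this n).2
  have hX1 : ∀ d : (Γ₁ ⊔ Γ₂).Dart, Γ₁.Adj d.fst d.snd →
      d ∈ Set.range (dartMap (Γ' := Γ₁) (Γ := Γ₁ ⊔ Γ₂) id fun _ _ h => Or.inl h) :=
    fun d hd => ⟨⟨(d.fst, d.snd), hd⟩, rfl⟩
  have hX2 : ∀ d : (Γ₁ ⊔ Γ₂).Dart, ¬ Γ₁.Adj d.fst d.snd →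
      d ∈ Set.range (dartMap (Γ' := Γ₂) (Γ := Γ₁ ⊔ Γ₂) id fun _ _ h => Or.inr h) :=
    fun d hd => ⟨⟨(d.fst, d.snd), d.adj.resolve_left hd⟩, rfl⟩
  obtain ⟨R₁, hR₁⟩ := exists_rotationSystem (Γ' := Γ₁) (Γ := Γ₁ ⊔ Γ₂) (f := id)
    (hf := fun _ _ h => Or.inl h) (Set.injOn_id _) (σ := σ) (fun d => hfst _)
    (fun d => hX1 _ ((h2 _).2 d.adj)) (fun d d' hdd => by
      by_cases hd : d.fst = e
      · exact h3 _ hd _ (hdd.symm.trans hd) (iff_of_true d.adj d'.adj)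
      · exact hcyc _ _ hdd hd)
  have hnot : ∀ d : Γ₂.Dart, ¬ Γ₁.Adj d.fst d.snd := fun d hh => not_adj_of_adj hsep hh d.adj
  obtain ⟨R₂, hR₂⟩ := exists_rotationSystem (Γ' := Γ₂) (Γ := Γ₁ ⊔ Γ₂) (f := id)
    (hf := fun _ _ h => Or.inr h) (Set.injOn_id _) (σ := σ) (fun d => hfst _)
    (fun d => hX2 _ (fun hh => hnot d ((h2 _).1 hh))) (fun d d' hdd => by
      by_cases hd : d.fst = e
      · exact h3 _ hd _ (hdd.symm.trans hd) (iff_of_false (hnot d) (hnot d'))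
      · exact hcyc _ _ hdd hd)
  have hadd := genusDefect_eq_add (dartSumEquiv hsep) (σ := σ) (τ := (Γ₁ ⊔ Γ₂).dartSymm)
    (σA := R₁.next) (τA := Γ₁.dartSymm) (σB := R₂.next) (τB := Γ₂.dartSymm)
    (fun d => (hR₁ d).symm) (fun d => rfl) (fun d => (hR₂ d).symm) (fun d => rfl)
  obtain ⟨a, ha⟩ := exists_genusDefect_eq R₁.next Γ₁.dartSymm
  obtain ⟨b, hb⟩ := exists_genusDefect_eq R₂.next Γ₂.dartSymm
  refine ⟨a, b, ?_, embedsInSphereWithHandles_iff.2 ⟨R₁, ha.ge⟩,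
    embedsInSphereWithHandles_iff.2 ⟨R₂, hb.ge⟩⟩
  rw [ha, hb] at hadd
  omega

end CutVertex

end SimpleGraph

/-! ### Euler's bound and explicit triangulations -/

namespace Equiv.Perm

variable {D : Type*} [Finite D]

theorem three_mul_numCycles_le {φ : Perm D} (h : ∀ d, φ d ≠ d ∧ φ (φ d) ≠ d) :
    3 * numCycles φ ≤ Nat.card D := by
  rw [numCycles, mul_comm, ← Nat.card_fin 3, ← Nat.card_prod]
  refine Nat.card_le_card_of_injective
    (fun p : Quotient (SameCycle.setoid φ) × Fin 3 => (φ ^ (p.2 : ℕ)) p.1.out) ?_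
  rintro ⟨q, i⟩ ⟨q', j⟩ hij
  dsimp only at hij
  have hq : q = q' := by
    rw [← Quotient.out_eq q, ← Quotient.out_eq q']
    refine Quotient.sound (?_ : φ.SameCycle _ _)
    rw [← sameCycle_pow_left (n := i), hij]
    exact sameCycle_pow_left.2 (SameCycle.refl _ _)
  subst hq
  obtain ⟨h1, h2⟩ := h q.out
  have h3 : φ (φ q.out) ≠ φ q.out := fun hh => h1 (φ.injective hh)
  fin_cases i <;> fin_cases j <;> simp_all [pow_two, eq_comm]

theorem card_le_three_mul_numCycles {φ : Perm D} (h : ∀ d, φ (φ (φ d)) = d) :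
    Nat.card D ≤ 3 * numCycles φ := by
  rw [numCycles, mul_comm, ← Nat.card_fin 3, ← Nat.card_prod]
  refine Nat.card_le_card_of_surjective
    (fun p : Quotient (SameCycle.setoid φ) × Fin 3 => (φ ^ (p.2 : ℕ)) p.1.out) fun d => ?_
  obtain ⟨n, hn⟩ := SameCycle.exists_nat_pow_eq
    (show φ.SameCycle (Quotient.mk (SameCycle.setoid φ) d).out d from
      Quotient.exact (s := SameCycle.setoid φ) (Quotient.out_eq _))
  refine ⟨(Quotient.mk _ d, ⟨n % 3, Nat.mod_lt _ (by norm_num)⟩), ?_⟩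
  have h3 : φ ^ 3 = 1 := Equiv.ext fun x => by simpa [pow_succ] using h x
  change (φ ^ (n % 3)) _ = d
  conv_rhs => rw [← hn, ← Nat.mod_add_div n 3, pow_add, pow_mul, h3, one_pow, mul_one]

end Equiv.Perm

namespace SimpleGraph

open Equiv.Perm

variable {V : Type*}

/-- The consequence `E ≤ 3 V - 6 + 6 g` of Euler's formula, valid since all faces have at least three
sides. -/
theorem EmbedsInSphereWithHandles.card_edgeSet_le [Finite V] {Γ : SimpleGraph V} {g : ℕ}
    (h : Γ.EmbedsInSphereWithHandles g) (hc : Γ.Connected)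
    (hdeg : ∀ v u, ∃ w, w ≠ u ∧ Γ.Adj v w) :
    Nat.card Γ.edgeSet + 6 ≤ 3 * Nat.card V + 6 * g := by
  obtain ⟨R, hR⟩ := h
  have hcc : Nat.card Γ.ConnectedComponent = 1 := by
    have := hc.preconnected.subsingleton_connectedComponent
    have : Nonempty Γ.ConnectedComponent := hc.nonempty.map Γ.connectedComponentMk
    exact Nat.card_unique
  have hiso : Nat.card {v : V // ∀ w, ¬ Γ.Adj v w} = 0 := by
    have : IsEmpty {v : V // ∀ w, ¬ Γ.Adj v w} := ⟨fun v => by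
      obtain ⟨w, -, hw⟩ := hdeg v v
      exact v.2 w hw⟩
    exact Nat.card_of_isEmpty
  have hF : 3 * numCycles R.facePerm ≤ 2 * Nat.card Γ.edgeSet := by
    rw [← card_dart]
    have hfst : ∀ d, (R.facePerm d).fst = d.snd := fun d => R.fst_next d.symm
    refine three_mul_numCycles_le fun d => ⟨fun hd => ?_, fun hd => ?_⟩
    · exact d.adj.ne (by rw [← hfst d, hd])
    · have h1 : (R.facePerm d).snd = d.fst := by rw [← hfst (R.facePerm d), hd]
      have h2 : R.next d.symm = d.symm := Dart.ext _ _ (Prod.ext (hfst d) h1)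
      obtain ⟨w, hw, hadj⟩ := hdeg d.snd d.fst
      have h3 := R.sameCycle_next d.symm ⟨(d.snd, w), hadj⟩ rfl
      exact hw (congrArg (fun d : Γ.Dart => d.snd) (h3.eq_of_left h2)).symm
  have hN : R.numFaces = numCycles R.facePerm := by
    rw [RotationSystem.numFaces, hiso, add_zero]; rfl
  rw [RotationSystem.eulerChar, hcc, hN] at hR
  omega

/-- A rotation system all of whose faces are triangles, described by the function `s` which maps a
neighbour `v` of `u` to the next neighbour `s u v` around `u`. -/
theorem embedsInSphereWithHandles_of_triangulation [Finite V] {Γ : SimpleGraph V} {g : ℕ}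
    (s : V → V → V) (hadj : ∀ u v, Γ.Adj u v → Γ.Adj u (s u v))
    (htri : ∀ u v, Γ.Adj u v → s (s v u) v = u ∧ s u (s v u) = v)
    (hcyc : ∀ u v w, Γ.Adj u v → Γ.Adj u w → ∃ k : ℕ, (s u)^[k] v = w) (hc : Γ.Connected)
    (hE : Nat.card Γ.edgeSet + 6 ≤ 3 * Nat.card V + 6 * g) :
    Γ.EmbedsInSphereWithHandles g := by
  have hinj : Function.Injective
      (fun d : Γ.Dart => (⟨(d.fst, s d.fst d.snd), hadj _ _ d.adj⟩ : Γ.Dart)) := by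
    rintro ⟨⟨u, v⟩, h⟩ ⟨⟨u', v'⟩, h'⟩ he
    have h1 : u = u' := congrArg (fun d : Γ.Dart => d.fst) he
    subst h1
    have h2 : s u v = s u v' := congrArg (fun d : Γ.Dart => d.snd) he
    have h3 := (htri v u (Γ.adj_symm h)).1
    have h4 := (htri v' u (Γ.adj_symm h')).1
    rw [h2, h4] at h3
    subst h3
    rfl
  let σ : Equiv.Perm Γ.Dart := Equiv.ofBijective _ (Finite.injective_iff_bijective.1 hinj)
  have hpow : ∀ (k : ℕ) (d : Γ.Dart), ((σ ^ k) d).fst = d.fst ∧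
      ((σ ^ k) d).snd = (s d.fst)^[k] d.snd := by
    intro k d
    induction k with
    | zero => exact ⟨rfl, rfl⟩
    | succ k ih =>
      rw [pow_succ', mul_apply, Function.iterate_succ_apply', ← ih.2, ← ih.1]
      exact ⟨rfl, rfl⟩
  let R : Γ.RotationSystem := ⟨σ, fun _ => rfl, fun d d' h => by
    obtain ⟨k, hk⟩ := hcyc d.fst d.snd d'.snd d.adj (h ▸ d'.adj)
    have : (σ ^ k) d = d' :=
      Dart.ext _ _ (Prod.ext ((hpow k d).1.trans h) ((hpow k d).2.trans hk))
    exact this ▸ sameCycle_pow_right.2 (SameCycle.refl _ _)⟩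
  refine ⟨R, ?_⟩
  have hcc : Nat.card Γ.ConnectedComponent = 1 := by
    have := hc.preconnected.subsingleton_connectedComponent
    have : Nonempty Γ.ConnectedComponent := hc.nonempty.map Γ.connectedComponentMk
    exact Nat.card_unique
  have hF : 2 * Nat.card Γ.edgeSet ≤ 3 * numCycles R.facePerm := by
    rw [← card_dart]
    refine card_le_three_mul_numCycles fun d => ?_
    obtain ⟨h1, h2⟩ := htri d.fst d.snd d.adj
    refine Dart.ext _ _ (Prod.ext h1 ?_)
    change s (s (s d.snd d.fst) d.snd) (s d.snd d.fst) = d.snd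
    rw [h1, h2]
  have hN : numCycles R.facePerm ≤ R.numFaces := Nat.le_add_right _ _
  rw [RotationSystem.eulerChar, hcc]
  omega

theorem connected_of_forall_adj {Γ : SimpleGraph V} (c : V) (h : ∀ v, v ≠ c → Γ.Adj c v) :
    Γ.Connected := by
  have hr : ∀ v, Γ.Reachable c v := fun v => by
    by_cases hv : v = c
    · exact hv ▸ Reachable.refl _
    · exact (h v hv).reachable
  have : Nonempty V := ⟨c⟩
  exact ⟨fun u v => (hr u).symm.trans (hr v)⟩

/-- The element following `v` in the list `l` in cyclic order. -/
def cyclicSucc {n : ℕ} (l : List (Fin n)) (v : Fin n) : Fin n :=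
  l.getD ((l.idxOf v + 1) % l.length) v

/-- The graph on `Fin n` with given lists of neighbours. -/
abbrev ofNeighbors {n : ℕ} (L : Fin n → List (Fin n)) : SimpleGraph (Fin n) :=
  SimpleGraph.fromRel fun u v => v ∈ L u

theorem ofNeighbors_embedsInSphereWithHandles {n : ℕ} (L : Fin (n + 1) → List (Fin (n + 1)))
    (g : ℕ)
    (h : ∀ u v, (ofNeighbors L).Adj u v → (ofNeighbors L).Adj u (cyclicSucc (L u) v) ∧
      cyclicSucc (L (cyclicSucc (L v) u)) v = u ∧ cyclicSucc (L u) (cyclicSucc (L v) u) = v ∧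
      ∀ w, (ofNeighbors L).Adj u w → ∃ k ∈ List.range n, (cyclicSucc (L u))^[k] v = w)
    (hc : ∀ v, v ≠ 0 → (ofNeighbors L).Adj 0 v)
    (hE : (ofNeighbors L).edgeFinset.card + 6 ≤ 3 * (n + 1) + 6 * g) :
    (ofNeighbors L).EmbedsInSphereWithHandles g := by
  refine embedsInSphereWithHandles_of_triangulation (fun u => cyclicSucc (L u))
    (fun u v huv => (h u v huv).1) (fun u v huv => ⟨(h u v huv).2.1, (h u v huv).2.2.1⟩)
    (fun u v w huv huw => ?_) (connected_of_forall_adj 0 hc) ?_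
  · obtain ⟨k, -, hk⟩ := (h u v huv).2.2.2 w huw
    exact ⟨k, hk⟩
  · rwa [Nat.card_eq_fintype_card, ← edgeFinset_card, Nat.card_fin]

theorem completeGraph_four_embeds : (⊤ : SimpleGraph (Fin 4)).EmbedsInSphereWithHandles 0 :=
  (ofNeighbors_embedsInSphereWithHandles ![[1, 2, 3], [0, 3, 2], [0, 1, 3], [0, 2, 1]] 0
    (by decide +kernel) (by decide +kernel) (by decide +kernel)).of_injOn id (by decide +kernel)
    (Set.injOn_id _)

/-- `K₇` triangulates the torus: around `u`, the differences `v - u` run through the powers of `3`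
modulo `7`. -/
theorem completeGraph_seven_embeds : (⊤ : SimpleGraph (Fin 7)).EmbedsInSphereWithHandles 1 :=
  (ofNeighbors_embedsInSphereWithHandles (fun u => [u + 1, u + 3, u + 2, u + 6, u + 4, u + 5]) 1
    (by decide +kernel) (by decide +kernel) (by decide +kernel)).of_injOn id (by decide +kernel)
    (Set.injOn_id _)

/-- `K₈` is drawn on the double torus with sixteen triangles and two quadrilaterals; the vertices `8`
and `9` are placed in the latter. -/
theorem completeGraph_eight_embeds : (⊤ : SimpleGraph (Fin 8)).EmbedsInSphereWithHandles 2 :=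
  (ofNeighbors_embedsInSphereWithHandles ![[1, 8, 4, 6, 9, 3, 2, 5, 7], [0, 7, 2, 6, 4, 3, 5, 8],
      [5, 0, 3, 6, 1, 7, 4], [1, 4, 7, 6, 2, 0, 9, 5], [5, 2, 7, 3, 1, 6, 0, 8],
      [0, 2, 4, 8, 1, 3, 9, 6, 7], [3, 7, 5, 9, 0, 4, 1, 2], [2, 1, 0, 5, 6, 3, 4], [1, 5, 4, 0],
      [6, 5, 3, 0]] 2
    (by decide +kernel) (by decide +kernel) (by decide +kernel)).of_injOn (Fin.castLE (by norm_num))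
    (by decide +kernel) (Fin.castLE_injective _).injOn

/-- The union of two copies of `K₇` sharing a triangle. -/
def doubleSeven : SimpleGraph (Fin 3 ⊕ Fin 2 × Fin 4) :=
  SimpleGraph.fromRel fun x y => ∀ p q, x = Sum.inr p → y = Sum.inr q → p.1 = q.1

instance : DecidableRel doubleSeven.Adj := fun x y =>
  decidable_of_iff (x ≠ y ∧ ((x.elim (fun _ => true) fun p => y.elim (fun _ => true) fun q =>
    decide (p.1 = q.1)) = true)) <| by
    rw [doubleSeven, fromRel_adj]
    refine and_congr_right fun _ => ?_
    rcases x with x | x <;> rcases y with y | y <;> simp [eq_comm]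

/-- Two triangulations of the torus by `K₇` glued along a triangle. -/
theorem doubleSeven_embeds : doubleSeven.EmbedsInSphereWithHandles 2 :=
  (ofNeighbors_embedsInSphereWithHandles ![[1, 4, 3, 6, 5, 2, 8, 7, 10, 9],
      [2, 6, 3, 5, 4, 0, 9, 7, 8, 10], [0, 5, 3, 4, 6, 1, 10, 7, 9, 8], [4, 2, 5, 1, 6, 0],
      [5, 6, 2, 3, 0, 1], [2, 0, 6, 4, 1, 3], [0, 3, 1, 2, 4, 5], [8, 1, 9, 2, 10, 0],
      [9, 10, 1, 7, 0, 2], [1, 0, 10, 8, 2, 7], [0, 7, 2, 1, 8, 9]] 2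
    (by decide +kernel) (by decide +kernel) (by decide +kernel)).of_injOn
    (Sum.elim (fun i => Fin.castLE (by norm_num) i)
      fun p => if p.1 = 0 then Fin.natAdd 3 (Fin.castLE (m := 8) (by norm_num) p.2)
        else Fin.natAdd 7 p.2)
    (by decide +kernel) (Function.Injective.injOn (by decide +kernel))

theorem choose_le_of_completeGraph {n g : ℕ} (hn : 3 ≤ n)
    (h : (⊤ : SimpleGraph (Fin n)).EmbedsInSphereWithHandles g) :
    n.choose 2 + 6 ≤ 3 * n + 6 * g := by
  have : NeZero n := ⟨by omega⟩
  have h1 := h.card_edgeSet_le connected_top fun v u => by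
    obtain ⟨w, -, hw⟩ := Finset.exists_mem_notMem_of_card_lt_card
      (s := {u, v}) (t := (Finset.univ : Finset (Fin n)))
      (Finset.card_le_two.trans_lt (by rw [Finset.card_univ, Fintype.card_fin]; omega))
    rw [Finset.mem_insert, Finset.mem_singleton, not_or] at hw
    exact ⟨w, hw.1, Ne.symm hw.2⟩
  rw [Nat.card_eq_fintype_card, ← edgeFinset_card, card_edgeFinset_top_eq_card_choose_two,
    Fintype.card_fin, Nat.card_fin] at h1
  exact h1

end SimpleGraph

/-! ### The normal subgroup based power graph and its blocks -/

open SimpleGraph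

section PowerLinked

variable {Q : Type*} [Group Q]

/-- One of the two elements is a power of the other. -/
def PowerLinked (p q : Q) : Prop := (∃ m : ℤ, p = q ^ m) ∨ ∃ m : ℤ, q = p ^ m

theorem PowerLinked.refl (p : Q) : PowerLinked p p := Or.inl ⟨1, (zpow_one p).symm⟩

theorem PowerLinked.symm {p q : Q} (h : PowerLinked p q) : PowerLinked q p := Or.symm h

theorem PowerLinked.one_left (q : Q) : PowerLinked 1 q := Or.inl ⟨0, (zpow_zero q).symm⟩

theorem PowerLinked.inv_right (p : Q) : PowerLinked p p⁻¹ := Or.inr ⟨-1, (zpow_neg_one p).symm⟩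

end PowerLinked

namespace normalSubgroupPowerGraph

variable {G : Type*} [Group G] {H : Subgroup G}

/-- The vertex `e`. -/
def base (H : Subgroup G) : {x : G // x ∉ H ∨ x = 1} := ⟨1, Or.inr rfl⟩

/-- The coset of a vertex. -/
def coset (x : {x : G // x ∉ H ∨ x = 1}) : G ⧸ H := QuotientGroup.mk (x : G)

variable [H.Normal]

theorem coset_eq_one_iff {x : {x : G // x ∉ H ∨ x = 1}} : coset x = 1 ↔ x = base H := by
  rw [coset, QuotientGroup.eq_one_iff]
  constructor
  · exact fun h => Subtype.ext (x.2.resolve_left (not_not.2 h))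
  · rintro rfl; exact H.one_mem

theorem adj_iff {x y : {x : G // x ∉ H ∨ x = 1}} :
    (normalSubgroupPowerGraph H).Adj x y ↔ x ≠ y ∧ PowerLinked (coset x) (coset y) := by
  rw [normalSubgroupPowerGraph, fromRel_adj]
  rfl

/-- The part of the graph that lies over the set `S` of cosets and the identity coset, as a graph on
all the vertices. -/
def block (H : Subgroup G) [H.Normal] (S : Set (G ⧸ H)) :
    SimpleGraph {x : G // x ∉ H ∨ x = 1} where
  Adj x y := (normalSubgroupPowerGraph H).Adj x y ∧
    (coset x ∈ S ∨ coset x = 1) ∧ (coset y ∈ S ∨ coset y = 1)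
  symm := ⟨fun _ _ h => ⟨h.1.symm, h.2.2, h.2.1⟩⟩
  loopless := ⟨fun _ h => h.1.ne rfl⟩

theorem block_eq_of_forall {S : Set (G ⧸ H)} (h : ∀ q, q ≠ 1 → q ∈ S) :
    block H S = normalSubgroupPowerGraph H := by
  ext x y
  refine ⟨fun hh => hh.1, fun hh => ⟨hh, ?_, ?_⟩⟩
  · by_cases hx : coset x = 1
    · exact Or.inr hx
    · exact Or.inl (h _ hx)
  · by_cases hx : coset y = 1
    · exact Or.inr hx
    · exact Or.inl (h _ hx)

theorem block_mono {S T : Set (G ⧸ H)} (h : S ⊆ T) : block H S ≤ block H T :=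
  fun _ _ hh => ⟨hh.1, hh.2.1.imp_left fun k => h k, hh.2.2.imp_left fun k => h k⟩

theorem eq_base_of_adj_block {S T : Set (G ⧸ H)} (h : Disjoint S T)
    (v u w : {x : G // x ∉ H ∨ x = 1}) (h1 : (block H S).Adj v u) (h2 : (block H T).Adj v w) :
    v = base H := by
  rw [← coset_eq_one_iff]
  rcases h1.2.1 with h3 | h3
  · rcases h2.2.1 with h4 | h4
    · exact absurd h4 (Set.disjoint_left.1 h h3)
    · exact h4
  · exact h3

theorem card_fiber {S : Set (G ⧸ H)} (hS : 1 ∉ S) :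
    Nat.card {x : {x : G // x ∉ H ∨ x = 1} // coset x ∈ S} = S.ncard * Nat.card H := by
  have h1 : Nat.card {x : {x : G // x ∉ H ∨ x = 1} // coset x ∈ S} =
      Nat.card ((QuotientGroup.mk : G → G ⧸ H) ⁻¹' S) := by
    refine Nat.card_congr (Equiv.ofBijective (fun x => ⟨x.1.1, x.2⟩) ⟨fun x y h => ?_, fun x => ?_⟩)
    · exact Subtype.ext (Subtype.ext (congrArg (fun z => z.1) h))
    · refine ⟨⟨⟨x.1, Or.inl fun hx => hS ?_⟩, x.2⟩, rfl⟩
      rw [← (QuotientGroup.eq_one_iff x.1).2 hx]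
      exact x.2
  rw [h1, Nat.card_congr (QuotientGroup.preimageMkEquivSubgroupProdSet H S), Nat.card_prod,
    mul_comm, Nat.card_coe_set_eq]

variable [Finite G]

theorem embeds_block_of_embeds {g : ℕ}
    (h : (normalSubgroupPowerGraph H).EmbedsInSphereWithHandles g) (S : Set (G ⧸ H)) :
    (block H S).EmbedsInSphereWithHandles g :=
  h.of_injOn id (fun _ _ hh => hh.1) (Set.injOn_id _)

theorem exists_of_embeds_block_union {S T : Set (G ⧸ H)} (hST : Disjoint S T) {g : ℕ}
    (h : (block H (S ∪ T)).EmbedsInSphereWithHandles g) :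
    ∃ a b : ℕ, a + b ≤ g ∧ (block H S).EmbedsInSphereWithHandles a ∧
      (block H T).EmbedsInSphereWithHandles b := by
  refine EmbedsInSphereWithHandles.exists_of_sup (e := base H) (h.of_injOn id ?_ (Set.injOn_id _))
    (eq_base_of_adj_block hST)
  rintro u v (hh | hh)
  · exact block_mono Set.subset_union_left hh
  · exact block_mono Set.subset_union_right hh

theorem embeds_block_union {S T : Set (G ⧸ H)} (hST : Disjoint S T)
    (hlink : ∀ p ∈ S, ∀ q ∈ T, ¬ PowerLinked p q) {a b : ℕ}
    (hS : (block H S).EmbedsInSphereWithHandles a) (hT : (block H T).EmbedsInSphereWithHandles b) :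
    (block H (S ∪ T)).EmbedsInSphereWithHandles (a + b) := by
  refine (hS.sup hT (eq_base_of_adj_block hST)).of_injOn id (fun u v h => ?_) (Set.injOn_id _)
  obtain ⟨h1, h2, h3⟩ := h
  have h4 := (adj_iff.1 h1).2
  rcases h2 with (h2 | h2) | h2 <;> rcases h3 with (h3 | h3) | h3
  · exact Or.inl ⟨h1, Or.inl h2, Or.inl h3⟩
  · exact absurd h4 (hlink _ h2 _ h3)
  · exact Or.inl ⟨h1, Or.inl h2, Or.inr h3⟩
  · exact absurd h4.symm (hlink _ h3 _ h2)
  · exact Or.inr ⟨h1, Or.inl h2, Or.inl h3⟩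
  · exact Or.inr ⟨h1, Or.inl h2, Or.inr h3⟩
  · exact Or.inl ⟨h1, Or.inr h2, Or.inl h3⟩
  · exact Or.inr ⟨h1, Or.inr h2, Or.inl h3⟩
  · exact Or.inl ⟨h1, Or.inr h2, Or.inr h3⟩

theorem embeds_completeGraph_of_embeds_block {S : Set (G ⧸ H)} (hS : 1 ∉ S)
    (hlink : ∀ p ∈ S, ∀ q ∈ S, PowerLinked p q) {n g : ℕ} (hn : n ≤ S.ncard * Nat.card H)
    (h : (block H S).EmbedsInSphereWithHandles g) :
    (⊤ : SimpleGraph (Fin (n + 1))).EmbedsInSphereWithHandles g := by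
  have : Finite {x : {x : G // x ∉ H ∨ x = 1} // coset x ∈ S} := inferInstance
  rw [← card_fiber hS] at hn
  have hf : ∃ f : Fin n → {x : {x : G // x ∉ H ∨ x = 1} // coset x ∈ S}, Function.Injective f := by
    refine ⟨fun i => (Finite.equivFin _).symm (Fin.castLE hn i), ?_⟩
    exact (Equiv.injective _).comp (Fin.castLE_injective hn)
  obtain ⟨f, hf⟩ := hf
  let F : Fin (n + 1) → {x : G // x ∉ H ∨ x = 1} := Fin.cons (base H) fun i => (f i).1
  have hF : ∀ i, coset (F i) ∈ S ∨ coset (F i) = 1 := by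
    intro i
    refine Fin.cases (Or.inr (coset_eq_one_iff.2 rfl)) (fun i => Or.inl (f i).2) i
  have hinj : Function.Injective F := by
    refine Fin.cons_injective_iff.2 ⟨?_, Subtype.val_injective.comp hf⟩
    rintro ⟨i, hi⟩
    exact hS (coset_eq_one_iff.2 hi ▸ (f i).2)
  refine h.of_injOn F (fun u v huv => ⟨?_, hF u, hF v⟩) hinj.injOn
  refine adj_iff.2 ⟨fun hh => huv.ne (hinj hh), ?_⟩
  rcases hF u with hu | hu
  · rcases hF v with hv | hv
    · exact hlink _ hu _ hv
    · rw [hv]; exact (PowerLinked.one_left _).symm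
  · rw [hu]; exact PowerLinked.one_left _

theorem embeds_block_of_embeds_completeGraph {S : Set (G ⧸ H)} (hS : 1 ∉ S) {n g : ℕ}
    (hn : S.ncard * Nat.card H ≤ n)
    (h : (⊤ : SimpleGraph (Fin (n + 1))).EmbedsInSphereWithHandles g) :
    (block H S).EmbedsInSphereWithHandles g := by
  classical
  rw [← card_fiber hS] at hn
  let ε := Finite.equivFin {x : {x : G // x ∉ H ∨ x = 1} // coset x ∈ S}
  let F : {x : G // x ∉ H ∨ x = 1} → Fin (n + 1) := fun x =>
    if hx : coset x ∈ S then (Fin.castLE hn (ε ⟨x, hx⟩)).succ else 0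
  have hF : Set.InjOn F (block H S).support := by
    rintro x ⟨x', hx⟩ y ⟨y', hy⟩ hxy
    by_cases h1 : coset x ∈ S <;> by_cases h2 : coset y ∈ S
    · simp only [F, dif_pos h1, dif_pos h2] at hxy
      exact congrArg Subtype.val (ε.injective (Fin.castLE_injective hn (Fin.succ_injective _ hxy)))
    · simp only [F, dif_pos h1, dif_neg h2] at hxy
      exact absurd hxy (Fin.succ_ne_zero _)
    · simp only [F, dif_neg h1, dif_pos h2] at hxy
      exact absurd hxy.symm (Fin.succ_ne_zero _)
    · rw [coset_eq_one_iff.1 (hx.2.1.resolve_left h1), coset_eq_one_iff.1 (hy.2.1.resolve_left h2)]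
  refine h.of_injOn F (fun u v huv hh => ?_) hF
  exact huv.ne (hF ⟨v, huv⟩ ⟨u, huv.symm⟩ hh)

/-- Cosets related to no other coset span graphs `K_{h + 1}` attached at `e`, which are planar when
`h ≤ 3`. -/
theorem embeds_block_union_of_isolated (hcard : Nat.card H ≤ 3) {S T : Set (G ⧸ H)}
    (hT : ∀ q ∈ T, q ≠ 1 ∧ ∀ p, PowerLinked p q → p = 1 ∨ p = q) (hS : 1 ∉ S) {g : ℕ}
    (h : (block H S).EmbedsInSphereWithHandles g) :
    (block H (S ∪ T)).EmbedsInSphereWithHandles g := by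
  classical
  induction T, T.toFinite using Set.Finite.induction_on with
  | empty => rwa [Set.union_empty]
  | @insert q T _ _ ih =>
    have h1 := ih fun p hp => hT p (Set.mem_insert_of_mem _ hp)
    by_cases hq : q ∈ S ∪ T
    · rwa [Set.union_insert, Set.insert_eq_of_mem hq]
    · obtain ⟨hq1, hq2⟩ := hT q (Set.mem_insert _ _)
      rw [Set.union_insert, Set.insert_eq, Set.union_comm]
      refine embeds_block_union (b := 0) (Set.disjoint_singleton_right.2 hq) ?_ h1 ?_
      · rintro p hp _ rfl hl
        rcases hq2 p hl with rfl | rfl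
        · rcases hp with hp | hp
          · exact hS hp
          · exact (hT 1 (Set.mem_insert_of_mem _ hp)).1 rfl
        · exact hq hp
      · exact embeds_block_of_embeds_completeGraph (fun hh => hq1 hh.symm)
          (by rw [Set.ncard_singleton, one_mul]; exact hcard) completeGraph_four_embeds

end normalSubgroupPowerGraph

/-! ### Groups with few elements of order three or four -/

section GroupTheory

variable {Q : Type*} [Group Q]

theorem zpow_eq_one_or_self {p : Q} (hp : p ^ 2 = 1) (m : ℤ) : p ^ m = 1 ∨ p ^ m = p := by
  have hp' : p ^ (2 : ℤ) = 1 := by exact_mod_cast hp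
  rcases Int.even_or_odd' m with ⟨k, rfl | rfl⟩
  · left; rw [zpow_mul, hp', one_zpow]
  · right; rw [zpow_add, zpow_mul, hp', one_zpow, one_mul, zpow_one]

theorem zpow_cases {p : Q} (hp : p ^ 4 = 1) (m : ℤ) :
    p ^ m = 1 ∨ p ^ m = p ^ 2 ∨ p ^ m = p ∨ p ^ m = p⁻¹ := by
  have h2 : (p ^ 2) ^ 2 = 1 := by rw [← pow_mul]; exact hp
  have hinv : p ^ 2 * p = p⁻¹ := by
    rw [eq_inv_iff_mul_eq_one, ← hp]; group
  have h2' : p ^ (2 : ℤ) = p ^ 2 := by exact_mod_cast rfl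
  rcases Int.even_or_odd' m with ⟨k, rfl | rfl⟩
  · rw [zpow_mul, h2']
    rcases zpow_eq_one_or_self h2 k with h | h
    · exact Or.inl h
    · exact Or.inr (Or.inl h)
  · rw [zpow_add, zpow_mul, h2', zpow_one]
    rcases zpow_eq_one_or_self h2 k with h | h <;> rw [h]
    · rw [one_mul]; exact Or.inr (Or.inr (Or.inl rfl))
    · exact Or.inr (Or.inr (Or.inr hinv))

theorem conj_pow_eq_one_iff {a t : Q} {n : ℕ} : (t * a * t⁻¹) ^ n = 1 ↔ a ^ n = 1 := by
  rw [conj_pow, conj_eq_one_iff]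

theorem eq_one_of_sq_of_cube {a : Q} (h2 : a ^ 2 = 1) (h3 : a ^ 3 = 1) : a = 1 := by
  rwa [pow_succ, h2, one_mul] at h3

/-- Two cyclic subgroups of order `3` force a third one. -/
theorem exists_third_of_cube {a b : Q} (ha : a ^ 3 = 1) (ha1 : a ≠ 1) (hb : b ^ 3 = 1) (hb1 : b ≠ 1)
    (hab : b ≠ a) (hab' : b ≠ a⁻¹) :
    ∃ c, c ^ 3 = 1 ∧ c ≠ 1 ∧ c ≠ a ∧ c ≠ a⁻¹ ∧ c ≠ b ∧ c ≠ b⁻¹ := by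
  have hainv : a⁻¹ = a ^ 2 := by rw [inv_eq_iff_mul_eq_one, ← ha]; group
  have hbinv : b⁻¹ = b ^ 2 := by rw [inv_eq_iff_mul_eq_one, ← hb]; group
  by_cases h1 : a * b * a⁻¹ = b
  · have hc : Commute a b := by rw [commute_iff_eq]; exact mul_inv_eq_iff_eq_mul.1 h1
    refine ⟨a * b, by rw [hc.mul_pow, ha, hb, one_mul], fun h => ?_, fun h => ?_, fun h => ?_,
      fun h => ?_, fun h => ?_⟩
    · exact hab' (eq_inv_of_mul_eq_one_right h)
    · exact hb1 (mul_eq_left.1 h)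
    · rw [hainv, pow_two] at h
      exact hab (mul_left_cancel h)
    · exact ha1 (mul_eq_right.1 h)
    · rw [hbinv, pow_two] at h
      exact hab (mul_right_cancel h).symm
  · refine ⟨a * b * a⁻¹, conj_pow_eq_one_iff.2 hb, fun h => hb1 (conj_eq_one_iff.1 h),
      fun h => ?_, fun h => ?_, h1, fun h => ?_⟩
    · apply hab
      rw [mul_inv_eq_iff_eq_mul] at h
      exact mul_left_cancel h
    · apply hab'
      rw [mul_inv_eq_iff_eq_mul, inv_mul_cancel] at h
      exact eq_inv_of_mul_eq_one_right h
    · -- Conjugation by `a` would be an automorphism of order `2` of `⟨b⟩`.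
      have h2 : a * a * b * a⁻¹ * a⁻¹ = b := by
        calc a * a * b * a⁻¹ * a⁻¹ = a * (a * b * a⁻¹) * a⁻¹ := by simp only [mul_assoc]
          _ = a * b⁻¹ * a⁻¹ := by rw [h]
          _ = (a * b * a⁻¹)⁻¹ := by simp [mul_assoc]
          _ = b := by rw [h, inv_inv]
      have haa : a * a = a⁻¹ := by rw [hainv, pow_two]
      have haa' : a⁻¹ * a⁻¹ = a := by rw [← mul_inv_rev, haa, inv_inv]
      rw [haa, mul_assoc, haa'] at h2
      apply h1
      calc a * b * a⁻¹ = a * (a⁻¹ * b * a) * a⁻¹ := by rw [h2]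
        _ = b := by simp [mul_assoc]

/-- If `⟨a⟩` and `⟨b⟩` are the only cyclic subgroups of order `4`, they share their involution. -/
theorem sq_eq_sq_of_order_four {a b : Q} (ha : a ^ 4 = 1) (ha2 : a ^ 2 ≠ 1) (hb : b ^ 4 = 1)
    (hb2 : b ^ 2 ≠ 1)
    (hall : ∀ c : Q, c ^ 4 = 1 → c ^ 2 ≠ 1 → c = a ∨ c = a⁻¹ ∨ c = b ∨ c = b⁻¹) :
    a ^ 2 = b ^ 2 := by
  by_contra hne
  have hba : b ≠ a := fun h => hne (by rw [h])
  have hsq : ∀ {x : Q}, x ^ 4 = 1 → (x⁻¹) ^ 2 = x ^ 2 := fun {x} hx => by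
    rw [inv_pow, inv_eq_iff_mul_eq_one, ← pow_add]; exact hx
  have hba' : b ≠ a⁻¹ := fun h => hne (by rw [h, hsq ha])
  have hcomm : ¬ Commute a b := by
    intro hc
    have h4 : (a * b) ^ 4 = 1 := by rw [hc.mul_pow, ha, hb, one_mul]
    have h2 : (a * b) ^ 2 ≠ 1 := fun h => by
      rw [hc.mul_pow, mul_eq_one_iff_eq_inv, ← inv_pow, hsq hb] at h
      exact hne h
    rcases hall _ h4 h2 with h | h | h | h
    · rw [mul_eq_left.1 h, one_pow] at hb2; exact hb2 rfl
    · have : b = (a⁻¹) ^ 2 := by rw [pow_two]; exact eq_inv_mul_of_mul_eq h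
      apply hb2; rw [this, hsq ha, ← pow_mul]; exact ha
    · rw [mul_eq_right.1 h, one_pow] at ha2; exact ha2 rfl
    · have : a = (b⁻¹) ^ 2 := by rw [pow_two]; exact eq_mul_inv_of_mul_eq h
      apply ha2; rw [this, hsq hb, ← pow_mul]; exact hb
  have h1 : a * b * a⁻¹ = b⁻¹ := by
    rcases hall (a * b * a⁻¹) (conj_pow_eq_one_iff.2 hb) (fun h => hb2 (conj_pow_eq_one_iff.1 h))
      with h | h | h | h
    · rw [mul_inv_eq_iff_eq_mul] at h
      exact absurd (mul_left_cancel h) hba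
    · rw [mul_inv_eq_iff_eq_mul, inv_mul_cancel] at h
      exact absurd (eq_inv_of_mul_eq_one_right h) hba'
    · exact absurd (mul_inv_eq_iff_eq_mul.1 h) hcomm
    · exact h
  have h2 : b * a * b⁻¹ = a⁻¹ := by
    rcases hall (b * a * b⁻¹) (conj_pow_eq_one_iff.2 ha) (fun h => ha2 (conj_pow_eq_one_iff.1 h))
      with h | h | h | h
    · exact absurd (mul_inv_eq_iff_eq_mul.1 h).symm hcomm
    · exact h
    · rw [mul_inv_eq_iff_eq_mul] at h
      exact absurd (mul_left_cancel h).symm hba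
    · rw [mul_inv_eq_iff_eq_mul, inv_mul_cancel] at h
      exact absurd (eq_inv_of_mul_eq_one_left h) hba'
  rw [mul_inv_eq_iff_eq_mul] at h1 h2
  -- Here `a * b = b⁻¹ * a` and `b * a = a⁻¹ * b`.
  have h3 : a = a⁻¹ * b * b := by
    calc a = b * (b⁻¹ * a) := by simp
      _ = a⁻¹ * b * b := by rw [← h1, ← mul_assoc, h2]
  apply hne
  rw [pow_two, pow_two]
  nth_rewrite 2 [h3]
  simp [mul_assoc]

/-- If there are at most two cyclic subgroups of order `4`, namely `⟨a⟩` and `⟨b⟩`, then an element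
of order `3` commutes with `a ^ 2`, so that there is an element of order `6`. -/
theorem eq_one_of_cube_of_order_four {a b : Q} (ha : a ^ 4 = 1) (ha2 : a ^ 2 ≠ 1) (hb : b ^ 4 = 1)
    (hb2 : b ^ 2 ≠ 1)
    (hall : ∀ c : Q, c ^ 4 = 1 → c ^ 2 ≠ 1 → c = a ∨ c = a⁻¹ ∨ c = b ∨ c = b⁻¹)
    (hord : ∀ c : Q, c ^ 2 = 1 ∨ c ^ 3 = 1 ∨ c ^ 4 = 1) {z : Q} (hz : z ^ 3 = 1) : z = 1 := by
  by_contra hz1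
  have hsq : ∀ {x : Q}, x ^ 4 = 1 → (x⁻¹) ^ 2 = x ^ 2 := fun {x} hx => by
    rw [inv_pow, inv_eq_iff_mul_eq_one, ← pow_add]; exact hx
  have hab := sq_eq_sq_of_order_four ha ha2 hb hb2 hall
  have hconj : (z * a * z⁻¹) ^ 2 = a ^ 2 := by
    rcases hall (z * a * z⁻¹) (conj_pow_eq_one_iff.2 ha) (fun h => ha2 (conj_pow_eq_one_iff.1 h))
      with h | h | h | h
    · rw [h]
    · rw [h, hsq ha]
    · rw [h, hab]
    · rw [h, hsq hb, hab]
  rw [conj_pow] at hconj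
  have hc : Commute z (a ^ 2) := by rw [commute_iff_eq]; exact mul_inv_eq_iff_eq_mul.1 hconj
  have hs : (a ^ 2) ^ 2 = 1 := by rw [← pow_mul]; exact ha
  have hs3 : (a ^ 2) ^ 3 = a ^ 2 := by rw [pow_succ, hs, one_mul]
  have hz4 : z ^ 4 = z := by rw [pow_succ, hz, one_mul]
  rcases hord (z * a ^ 2) with h | h | h
  · rw [hc.mul_pow, hs, mul_one] at h
    exact hz1 (eq_one_of_sq_of_cube h hz)
  · rw [hc.mul_pow, hs3, hz, one_mul] at h
    exact ha2 h
  · rw [hc.mul_pow, hz4, ← pow_mul, mul_comm 2 4, pow_mul, ha, one_pow, mul_one] at h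
    exact hz1 h

/-- The group is cyclic of order `n` or dihedral of order `2 n`, as seen from a generator `a` of the
subgroup of rotations. -/
def IsCyclicOrDihedral (n : ℕ) (Q : Type*) [Group Q] : Prop :=
  ∃ a : Q, orderOf a = n ∧ ∀ t ∉ Subgroup.zpowers a, t ^ 2 = 1 ∧ t * a * t⁻¹ = a⁻¹

theorem IsCyclicOrDihedral.of_mulEquiv {P : Type*} [Group P] {n : ℕ} (h : IsCyclicOrDihedral n P)
    (e : P ≃* Q) : IsCyclicOrDihedral n Q := by
  obtain ⟨a, ha, ht⟩ := h
  refine ⟨e a, by rw [MulEquiv.orderOf_eq, ha], fun t hta => ?_⟩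
  obtain ⟨t, rfl⟩ := e.surjective t
  have : t ∉ Subgroup.zpowers a := by
    rintro ⟨k, rfl⟩
    exact hta ⟨k, (map_zpow e a k).symm⟩
  obtain ⟨h1, h2⟩ := ht t this
  exact ⟨by rw [← map_pow, h1, map_one], by rw [← map_mul, ← map_inv, ← map_mul, h2, map_inv]⟩

theorem isCyclicOrDihedral_of_order_three {a : Q} (ha : a ^ 3 = 1) (ha1 : a ≠ 1)
    (hall : ∀ c : Q, c ^ 3 = 1 → c ≠ 1 → c = a ∨ c = a⁻¹)
    (hord : ∀ c : Q, c ^ 2 = 1 ∨ c ^ 3 = 1) : IsCyclicOrDihedral 3 Q := by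
  refine ⟨a, orderOf_eq_prime ha ha1, fun t ht => ?_⟩
  have ht1 : t ≠ 1 := fun h => ht (h ▸ one_mem _)
  have hnot3 : t ^ 3 ≠ 1 := fun h => by
    rcases hall t h ht1 with rfl | rfl
    · exact ht (Subgroup.mem_zpowers _)
    · exact ht (inv_mem (Subgroup.mem_zpowers _))
  have ht2 : t ^ 2 = 1 := (hord t).resolve_right hnot3
  refine ⟨ht2, ?_⟩
  rcases hall (t * a * t⁻¹) (conj_pow_eq_one_iff.2 ha) (fun h => ha1 (conj_eq_one_iff.1 h))
    with h | h
  · have hc : Commute t a := by rw [commute_iff_eq]; exact mul_inv_eq_iff_eq_mul.1 h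
    rcases hord (t * a) with h' | h'
    · rw [hc.mul_pow, ht2, one_mul] at h'
      exact absurd (eq_one_of_sq_of_cube h' ha) ha1
    · rw [hc.mul_pow, ha, mul_one] at h'
      exact absurd h' hnot3
  · exact h

theorem orderOf_eq_four {a : Q} (ha : a ^ 4 = 1) (ha2 : a ^ 2 ≠ 1) : orderOf a = 4 :=
  orderOf_eq_prime_pow (p := 2) (n := 1) (by simpa using ha2) (by simpa using ha)

theorem isCyclicOrDihedral_of_order_four {a : Q} (ha : a ^ 4 = 1) (ha2 : a ^ 2 ≠ 1)
    (hall : ∀ c : Q, c ^ 4 = 1 → c ^ 2 ≠ 1 → c = a ∨ c = a⁻¹)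
    (hord : ∀ c : Q, c ^ 4 = 1) : IsCyclicOrDihedral 4 Q := by
  have hmem : ∀ c : Q, c ^ 2 ≠ 1 → c ∈ Subgroup.zpowers a := fun c hc => by
    rcases hall c (hord c) hc with rfl | rfl
    · exact Subgroup.mem_zpowers _
    · exact inv_mem (Subgroup.mem_zpowers _)
  refine ⟨a, orderOf_eq_four ha ha2, fun t ht => ?_⟩
  have ht2 : t ^ 2 = 1 := by
    by_contra h
    exact ht (hmem t h)
  refine ⟨ht2, ?_⟩
  rcases hall (t * a * t⁻¹) (hord _) (fun h => ha2 (conj_pow_eq_one_iff.1 h)) with h | h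
  · have hc : Commute t a := by rw [commute_iff_eq]; exact mul_inv_eq_iff_eq_mul.1 h
    have h1 : (t * a) ^ 2 ≠ 1 := by rwa [hc.mul_pow, ht2, one_mul]
    have h2 := hmem _ h1
    exact absurd ((Subgroup.mul_mem_cancel_right _ (Subgroup.mem_zpowers a)).1 h2) ht
  · exact h

theorem conj_zpowers_eq_inv {a t : Q} (h : t * a * t⁻¹ = a⁻¹) {x : Q}
    (hx : x ∈ Subgroup.zpowers a) : t * x * t⁻¹ = x⁻¹ := by
  obtain ⟨k, rfl⟩ := hx
  change t * a ^ k * t⁻¹ = (a ^ k)⁻¹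
  rw [← conj_zpow, h, inv_zpow]

theorem nonempty_dihedralGroup_mulEquiv [Finite Q] {n : ℕ} (hn : 3 ≤ n) {a t : Q}
    (ha : orderOf a = n)
    (hall : ∀ t ∉ Subgroup.zpowers a, t ^ 2 = 1 ∧ t * a * t⁻¹ = a⁻¹)
    (ht : t ∉ Subgroup.zpowers a) : Nonempty (Q ≃* DihedralGroup n) := by
  have hcard : Nat.card (Subgroup.zpowers a) = n := by rw [Nat.card_zpowers, ha]
  let e : Multiplicative (ZMod n) ≃* Subgroup.zpowers a :=
    hcard ▸ zmodCyclicMulEquiv (inferInstance : IsCyclic (Subgroup.zpowers a))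
  let p : ZMod n → Q := fun i => e (Multiplicative.ofAdd i)
  have hp : ∀ i, p i ∈ Subgroup.zpowers a := fun i => (e _).2
  have hadd : ∀ i j, p (i + j) = p i * p j := fun i j => by simp [p, ofAdd_add]
  have hsub : ∀ i j, p (i - j) = p i * (p j)⁻¹ := fun i j => by simp [p, ofAdd_sub, div_eq_mul_inv]
  obtain ⟨ht2, hta⟩ := hall t ht
  have htt : t * t = 1 := by rw [← pow_two]; exact ht2
  have htinv : t⁻¹ = t := inv_eq_of_mul_eq_one_left htt
  have hconj : ∀ i, p i * t = t * (p i)⁻¹ := fun i => by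
    have := conj_zpowers_eq_inv hta (hp i)
    rw [htinv] at this
    rw [← this, ← mul_assoc, ← mul_assoc, htt, one_mul]
  have hcomm : ∀ i j, p i * p j = p j * p i := fun i j => by rw [← hadd, add_comm, hadd]
  have hcomm_inv : ∀ i j, p i * (p j)⁻¹ = (p j)⁻¹ * p i := fun i j =>
    (show Commute (p i) (p j) from hcomm i j).inv_right
  let f : DihedralGroup n → Q := fun x => match x with
    | .r i => p i
    | .sr i => t * p i
  let F : DihedralGroup n →* Q := MonoidHom.mk' f <| by
    rintro (i | i) (j | j)
    · exact hadd i j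
    · change t * p (j - i) = p i * (t * p j)
      rw [← mul_assoc, hconj, hsub, hcomm_inv, mul_assoc]
    · change t * p (i + j) = t * p i * p j
      rw [hadd, mul_assoc]
    · change p (j - i) = t * p i * (t * p j)
      rw [mul_assoc, ← mul_assoc (p i), hconj, ← mul_assoc, ← mul_assoc, htt, one_mul, hsub,
        hcomm_inv]
  refine ⟨(MulEquiv.ofBijective F ⟨?_, fun x => ?_⟩).symm⟩
  · have hinj : Function.Injective p := fun i j h =>
      Multiplicative.ofAdd.injective (e.injective (Subtype.ext h))
    rintro (i | i) (j | j) h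
    · exact congrArg _ (hinj h)
    · have h' : p i = t * p j := h
      exact absurd ((Subgroup.mul_mem_cancel_right _ (hp j)).1 (h' ▸ hp i)) ht
    · have h' : t * p i = p j := h
      exact absurd ((Subgroup.mul_mem_cancel_right _ (hp i)).1 (h' ▸ hp j)) ht
    · exact congrArg _ (hinj (mul_left_cancel (h : t * p i = t * p j)))
  · have hsurj : ∀ y ∈ Subgroup.zpowers a, ∃ i, p i = y := fun y hy =>
      ⟨Multiplicative.toAdd (e.symm ⟨y, hy⟩), by simp [p]⟩
    by_cases hx : x ∈ Subgroup.zpowers a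
    · obtain ⟨i, hi⟩ := hsurj x hx
      exact ⟨.r i, hi⟩
    · -- `t * x` centralizes `a`, and `a` is not its own inverse.
      have htx : t * x ∈ Subgroup.zpowers a := by
        by_contra hn
        have h1 := (hall _ hn).2
        have h2 := (hall _ hx).2
        have h3 : t * x * a * (t * x)⁻¹ = a := by
          calc t * x * a * (t * x)⁻¹ = t * (x * a * x⁻¹) * t⁻¹ := by simp [mul_assoc]
            _ = (t * a * t⁻¹)⁻¹ := by rw [h2]; simp [mul_assoc]
            _ = a := by rw [hta, inv_inv]
        rw [h3] at h1
        have h4 : a ^ 2 = 1 := by rw [pow_two]; nth_rewrite 1 [h1]; exact inv_mul_cancel a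
        have := Nat.le_of_dvd two_pos (orderOf_dvd_of_pow_eq_one h4)
        omega
      obtain ⟨i, hi⟩ := hsurj _ htx
      refine ⟨.sr i, ?_⟩
      change t * p i = x
      rw [hi, ← mul_assoc, htt, one_mul]

theorem isCyclicOrDihedral_iff [Finite Q] {n : ℕ} (hn : 3 ≤ n) :
    IsCyclicOrDihedral n Q ↔
      Nonempty (Q ≃* Multiplicative (ZMod n)) ∨ Nonempty (Q ≃* DihedralGroup n) := by
  have : NeZero n := ⟨by omega⟩
  constructor
  · rintro ⟨a, ha, hall⟩
    by_cases h : ∃ t, t ∉ Subgroup.zpowers a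
    · obtain ⟨t, ht⟩ := h
      exact Or.inr (nonempty_dihedralGroup_mulEquiv hn ha hall ht)
    · push Not at h
      left
      have hc : IsCyclic Q := ⟨a, h⟩
      have hcard : Nat.card Q = n := by rw [← ha, orderOf_eq_card_of_forall_mem_zpowers h]
      exact ⟨(hcard ▸ zmodCyclicMulEquiv hc).symm⟩
  · rintro (⟨⟨e⟩⟩ | ⟨⟨e⟩⟩)
    · refine IsCyclicOrDihedral.of_mulEquiv ?_ e.symm
      refine ⟨Multiplicative.ofAdd 1, by simp [orderOf_ofAdd_eq_addOrderOf, ZMod.addOrderOf_one],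
        fun t ht => absurd ?_ ht⟩
      refine ⟨((Multiplicative.toAdd t).val : ℤ), ?_⟩
      change Multiplicative.ofAdd (1 : ZMod n) ^ ((Multiplicative.toAdd t).val : ℤ) = t
      rw [← ofAdd_zsmul]
      simp
    · refine IsCyclicOrDihedral.of_mulEquiv ?_ e.symm
      refine ⟨.r 1, DihedralGroup.orderOf_r_one, ?_⟩
      rintro (i | i) hi
      · refine absurd ⟨(i.val : ℤ), ?_⟩ hi
        change DihedralGroup.r (1 : ZMod n) ^ (i.val : ℤ) = _
        rw [zpow_natCast, DihedralGroup.r_one_pow, ZMod.natCast_zmod_val]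
      · constructor
        · rw [pow_two, DihedralGroup.sr_mul_self]
        · simp [DihedralGroup.inv_sr, DihedralGroup.inv_r]

theorem nonempty_perm_mulEquiv_dihedralGroup :
    Nonempty (Equiv.Perm (Fin 3) ≃* DihedralGroup 3) := by
  have h : ∀ t : Equiv.Perm (Fin 3), (t = 1 ∨ t = finRotate 3 ∨ t = finRotate 3 * finRotate 3) ∨
      t ^ 2 = 1 ∧ t * finRotate 3 * t⁻¹ = (finRotate 3)⁻¹ := by decide
  refine nonempty_dihedralGroup_mulEquiv (a := finRotate 3) (t := Equiv.swap 0 1) le_rfl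
    (orderOf_eq_prime (by decide) (by decide)) (fun t ht => (h t).resolve_left ?_) ?_
  · rintro (rfl | rfl | rfl)
    · exact ht (one_mem _)
    · exact ht (Subgroup.mem_zpowers _)
    · exact ht (mul_mem (Subgroup.mem_zpowers _) (Subgroup.mem_zpowers _))
  · rintro ⟨k, hk⟩
    have h1 := congrArg Equiv.Perm.sign hk
    rw [map_zpow, sign_finRotate, Equiv.Perm.sign_swap (by decide)] at h1
    revert h1
    simp

end GroupTheory

/-! ### Quotients for which the graph embeds in the double torus -/

section PowerLinked

variable {Q : Type*} [Group Q]

theorem eq_one_or_eq_of_powerLinked {p q : Q} (hq : q ^ 2 = 1) (hq1 : q ≠ 1)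
    (hp : (∃ m : ℤ, q = p ^ m) → p ^ 2 = 1) (h : PowerLinked p q) : p = 1 ∨ p = q := by
  rcases h with ⟨m, rfl⟩ | ⟨m, hm⟩
  · exact zpow_eq_one_or_self hq m
  · rcases zpow_eq_one_or_self (hp ⟨m, hm⟩) m with h | h
    · exact absurd (hm.trans h) hq1
    · exact Or.inr (hm.trans h).symm

end PowerLinked

namespace normalSubgroupPowerGraph

variable {G : Type*} [Group G] {H : Subgroup G} [H.Normal]

theorem four_le_ncard_pair (h2 : 2 ≤ Nat.card H) {a : G ⧸ H} (ha : a ^ 2 ≠ 1) :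
    4 ≤ ({a, a⁻¹} : Set (G ⧸ H)).ncard * Nat.card H := by
  rw [Set.ncard_pair fun h => ha (by rw [pow_two]; exact mul_eq_one_iff_eq_inv.2 h)]
  omega

variable [Finite G]

theorem ncard_mul_card_le {S : Set (G ⧸ H)} (hS : 1 ∉ S)
    (hlink : ∀ p ∈ S, ∀ q ∈ S, PowerLinked p q)
    (h : (normalSubgroupPowerGraph H).EmbedsInSphereWithHandles 2) :
    S.ncard * Nat.card H ≤ 7 := by
  by_contra hn
  have h1 := choose_le_of_completeGraph (by norm_num)
    (embeds_completeGraph_of_embeds_block hS hlink (n := 8) (by omega) (embeds_block_of_embeds h S))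
  simp [Nat.choose] at h1

theorem one_le_of_embeds_block {S : Set (G ⧸ H)} (hS : 1 ∉ S)
    (hlink : ∀ p ∈ S, ∀ q ∈ S, PowerLinked p q) (hcard : 4 ≤ S.ncard * Nat.card H) {g : ℕ}
    (h : (block H S).EmbedsInSphereWithHandles g) : 1 ≤ g := by
  have h1 := choose_le_of_completeGraph (by norm_num)
    (embeds_completeGraph_of_embeds_block hS hlink hcard h)
  simp [Nat.choose] at h1
  omega

theorem two_le_of_embeds {S T : Set (G ⧸ H)} (hS1 : 1 ∉ S) (hT1 : 1 ∉ T)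
    (hS : ∀ p ∈ S, ∀ q ∈ S, PowerLinked p q) (hT : ∀ p ∈ T, ∀ q ∈ T, PowerLinked p q)
    (hS4 : 4 ≤ S.ncard * Nat.card H) (hT4 : 4 ≤ T.ncard * Nat.card H) (hST : Disjoint S T) {g : ℕ}
    (h : (block H (S ∪ T)).EmbedsInSphereWithHandles g) : 2 ≤ g := by
  obtain ⟨a, b, hab, ha, hb⟩ := exists_of_embeds_block_union hST h
  have := one_le_of_embeds_block hS1 hS hS4 ha
  have := one_le_of_embeds_block hT1 hT hT4 hb
  omega

/-- Three copies of `K₅` attached at `e` do not fit on the double torus. -/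
theorem three_le_of_embeds {S T U : Set (G ⧸ H)} (hS1 : 1 ∉ S) (hT1 : 1 ∉ T) (hU1 : 1 ∉ U)
    (hS : ∀ p ∈ S, ∀ q ∈ S, PowerLinked p q) (hT : ∀ p ∈ T, ∀ q ∈ T, PowerLinked p q)
    (hU : ∀ p ∈ U, ∀ q ∈ U, PowerLinked p q)
    (hS4 : 4 ≤ S.ncard * Nat.card H) (hT4 : 4 ≤ T.ncard * Nat.card H)
    (hU4 : 4 ≤ U.ncard * Nat.card H) (hST : Disjoint S T) (hSU : Disjoint S U) (hTU : Disjoint T U)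
    {g : ℕ} (h : (normalSubgroupPowerGraph H).EmbedsInSphereWithHandles g) : 3 ≤ g := by
  obtain ⟨a, b, hab, ha, hb⟩ := exists_of_embeds_block_union
    (hSU.union_left hTU) (embeds_block_of_embeds h (S ∪ T ∪ U))
  have := two_le_of_embeds hS1 hT1 hS hT hS4 hT4 hST ha
  have := one_le_of_embeds_block hU1 hU hU4 hb
  omega

/-- The powers of `q` with exponents in `T` span a clique as soon as any two exponents divide one
another. -/
theorem card_mul_card_le (h : (normalSubgroupPowerGraph H).EmbedsInSphereWithHandles 2) (q : G ⧸ H)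
    (T : Finset ℤ) (hdvd : ∀ i ∈ T, ∀ j ∈ T, i ∣ j ∨ j ∣ i)
    (hT : ∀ i ∈ insert 0 T, ∀ j ∈ insert 0 T, |i - j| < orderOf q) (h0 : 0 ∉ T) :
    T.card * Nat.card H ≤ 7 := by
  have hinj : ∀ i ∈ insert 0 T, ∀ j ∈ insert 0 T, q ^ i = q ^ j → i = j := by
    intro i hi j hj hij
    have h1 : (orderOf q : ℤ) ∣ i - j := by
      rw [orderOf_dvd_iff_zpow_eq_one, zpow_sub, hij, mul_inv_cancel]
    have := Int.eq_zero_of_abs_lt_dvd h1 (hT i hi j hj)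
    omega
  have h1 := ncard_mul_card_le (S := (fun i : ℤ => q ^ i) '' (T : Set ℤ)) ?_ ?_ h
  · rwa [Set.InjOn.ncard_image, Set.ncard_coe_finset] at h1
    intro i hi j hj hij
    exact hinj i (Finset.mem_insert_of_mem hi) j (Finset.mem_insert_of_mem hj) hij
  · rintro ⟨i, hi, hi'⟩
    have := hinj i (Finset.mem_insert_of_mem hi) 0 (Finset.mem_insert_self _ _)
      (by simpa using hi')
    exact h0 (this ▸ hi)
  · rintro _ ⟨i, hi, rfl⟩ _ ⟨j, hj, rfl⟩
    rcases hdvd i hi j hj with ⟨k, rfl⟩ | ⟨k, rfl⟩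
    · exact Or.inr ⟨k, zpow_mul _ _ _⟩
    · exact Or.inl ⟨k, zpow_mul _ _ _⟩

theorem orderOf_le_four (h2 : 2 ≤ Nat.card H)
    (h : (normalSubgroupPowerGraph H).EmbedsInSphereWithHandles 2) (q : G ⧸ H) :
    orderOf q ≤ 4 := by
  by_contra hn
  have h1 := card_mul_card_le h q {1, -1, 2, -2} (by decide)
    (fun i hi j hj => by
      have : |i - j| ≤ 4 := by revert i j; decide
      have : (5 : ℤ) ≤ orderOf q := by exact_mod_cast (by omega : 5 ≤ orderOf q)
      omega) (by decide)
  rw [show ({1, -1, 2, -2} : Finset ℤ).card = 4 from rfl] at h1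
  omega

theorem card_le_two_of_order_four (h : (normalSubgroupPowerGraph H).EmbedsInSphereWithHandles 2)
    {q : G ⧸ H} (hq : q ^ 4 = 1) (hq2 : q ^ 2 ≠ 1) : Nat.card H ≤ 2 := by
  have h1 := card_mul_card_le h q {1, -1, 2} (by decide)
    (by rw [orderOf_eq_four hq hq2]; decide) (by decide)
  rw [show ({1, -1, 2} : Finset ℤ).card = 3 from rfl] at h1
  omega

theorem card_le_three_of_order_three
    (h : (normalSubgroupPowerGraph H).EmbedsInSphereWithHandles 2)
    {q : G ⧸ H} (hq : q ^ 3 = 1) (hq1 : q ≠ 1) : Nat.card H ≤ 3 := by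
  have h1 := card_mul_card_le h q {1, -1} (by decide)
    (by rw [orderOf_eq_prime hq hq1]; decide) (by decide)
  rw [show ({1, -1} : Finset ℤ).card = 2 from rfl] at h1
  omega

theorem powerLinked_of_mem_pair {Q : Type*} [Group Q] (a : Q) :
    ∀ p ∈ ({a, a⁻¹} : Set Q), ∀ q ∈ ({a, a⁻¹} : Set Q), PowerLinked p q := by
  rintro p (rfl | rfl) q (rfl | rfl)
  · exact PowerLinked.refl _
  · exact PowerLinked.inv_right _
  · exact (PowerLinked.inv_right _).symm
  · exact PowerLinked.refl _

theorem one_notMem_pair {Q : Type*} [Group Q] {a : Q} (ha : a ≠ 1) : (1 : Q) ∉ ({a, a⁻¹} : Set Q) := by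
  rintro (h | h)
  · exact ha h.symm
  · exact ha (inv_eq_one.1 (Eq.symm h))

theorem disjoint_pair {Q : Type*} [Group Q] {a b : Q} (h : b ≠ a) (h' : b ≠ a⁻¹) :
    Disjoint ({a, a⁻¹} : Set Q) {b, b⁻¹} := by
  rw [Set.disjoint_left]
  rintro _ (rfl | rfl) (k | k)
  · exact h k.symm
  · exact h' (by rw [k, inv_inv])
  · exact h' k.symm
  · exact h (inv_injective k).symm

theorem ne_one_of_sq_ne_one {Q : Type*} [Group Q] {a : Q} (ha : a ^ 2 ≠ 1) : a ≠ 1 :=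
  fun h => ha (by rw [h, one_pow])

/-- There are at most two pairs of mutually inverse elements of order greater than `2`: each gives a
`K₅` attached at `e`. -/
theorem eq_or_eq_of_sq_ne_one (h2 : 2 ≤ Nat.card H)
    (h : (normalSubgroupPowerGraph H).EmbedsInSphereWithHandles 2) {a b c : G ⧸ H}
    (ha : a ^ 2 ≠ 1) (hb : b ^ 2 ≠ 1) (hc : c ^ 2 ≠ 1) (hba : b ≠ a) (hba' : b ≠ a⁻¹) :
    c = a ∨ c = a⁻¹ ∨ c = b ∨ c = b⁻¹ := by
  by_contra! hn
  obtain ⟨h3, h4, h5, h6⟩ := hn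
  have := three_le_of_embeds (one_notMem_pair (ne_one_of_sq_ne_one ha))
    (one_notMem_pair (ne_one_of_sq_ne_one hb)) (one_notMem_pair (ne_one_of_sq_ne_one hc))
    (powerLinked_of_mem_pair a) (powerLinked_of_mem_pair b) (powerLinked_of_mem_pair c)
    (four_le_ncard_pair h2 ha) (four_le_ncard_pair h2 hb) (four_le_ncard_pair h2 hc)
    (disjoint_pair hba hba') (disjoint_pair h3 h4) (disjoint_pair h5 h6) h
  omega

/-- There are exactly two cyclic subgroups of order `4`, generated by `a` and by `b`, and all elements
outside of them have square `1`. -/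
def HasTwoCyclicFour (Q : Type*) [Group Q] : Prop :=
  ∃ a b : Q, a ^ 4 = 1 ∧ a ^ 2 ≠ 1 ∧ b ^ 4 = 1 ∧ b ^ 2 ≠ 1 ∧ b ≠ a ∧ b ≠ a⁻¹ ∧
    ∀ c : Q, c ^ 2 ≠ 1 → c = a ∨ c = a⁻¹ ∨ c = b ∨ c = b⁻¹

/-- The quotients and orders that can occur when the graph embeds in the double torus. -/
theorem classification (h2 : 2 ≤ Nat.card H)
    (h : (normalSubgroupPowerGraph H).EmbedsInSphereWithHandles 2) (hQ : 2 ≤ Nat.card (G ⧸ H)) :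
    (Nat.card (G ⧸ H) = 2 ∧ Nat.card H ≤ 7) ∨
    ((∀ q : G ⧸ H, q ^ 2 = 1) ∧ Nat.card H ≤ 3) ∨
    (IsCyclicOrDihedral 3 (G ⧸ H) ∧ Nat.card H ≤ 3) ∨
    (IsCyclicOrDihedral 4 (G ⧸ H) ∧ Nat.card H = 2) ∨
    (HasTwoCyclicFour (G ⧸ H) ∧ Nat.card H = 2) := by
  have hord : ∀ q : G ⧸ H, q ^ 2 = 1 ∨ q ^ 3 = 1 ∨ q ^ 4 = 1 := fun q => by
    have h3 := orderOf_le_four h2 h q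
    have h4 := orderOf_pos q
    have h5 := pow_orderOf_eq_one q
    generalize orderOf q = n at h3 h4 h5
    interval_cases n
    · left; rw [pow_one] at h5; rw [h5, one_pow]
    · exact Or.inl h5
    · exact Or.inr (Or.inl h5)
    · exact Or.inr (Or.inr h5)
  by_cases h4 : ∃ a : G ⧸ H, a ^ 4 = 1 ∧ a ^ 2 ≠ 1
  · obtain ⟨a, ha, ha2⟩ := h4
    have hH : Nat.card H = 2 := le_antisymm (card_le_two_of_order_four h ha ha2) h2
    by_cases hb : ∃ b : G ⧸ H, b ^ 4 = 1 ∧ b ^ 2 ≠ 1 ∧ b ≠ a ∧ b ≠ a⁻¹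
    · obtain ⟨b, hb, hb2, hba, hba'⟩ := hb
      exact Or.inr (Or.inr (Or.inr (Or.inr ⟨⟨a, b, ha, ha2, hb, hb2, hba, hba', fun c hc =>
        eq_or_eq_of_sq_ne_one h2 h ha2 hb2 hc hba hba'⟩, hH⟩)))
    · push Not at hb
      have hall : ∀ c : G ⧸ H, c ^ 4 = 1 → c ^ 2 ≠ 1 → c = a ∨ c = a⁻¹ := fun c hc hc2 => by
        by_cases hca : c = a
        · exact Or.inl hca
        · exact Or.inr (hb c hc hc2 hca)
      have h3 : ∀ z : G ⧸ H, z ^ 3 = 1 → z = 1 := fun z hz =>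
        eq_one_of_cube_of_order_four ha ha2 ha ha2
          (fun c hc hc2 => (hall c hc hc2).elim Or.inl fun h => Or.inr (Or.inl h)) hord hz
      refine Or.inr (Or.inr (Or.inr (Or.inl
        ⟨isCyclicOrDihedral_of_order_four ha ha2 hall fun c => ?_, hH⟩)))
      rcases hord c with hc | hc | hc
      · rw [show 4 = 2 * 2 from rfl, pow_mul, hc, one_pow]
      · rw [h3 c hc, one_pow]
      · exact hc
  push Not at h4
  have hord' : ∀ q : G ⧸ H, q ^ 2 = 1 ∨ q ^ 3 = 1 := fun q => by
    rcases hord q with hq | hq | hq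
    · exact Or.inl hq
    · exact Or.inr hq
    · exact Or.inl (h4 q hq)
  have hsq : ∀ {q : G ⧸ H}, q ^ 3 = 1 → q ≠ 1 → q ^ 2 ≠ 1 := fun hq hq1 h =>
    hq1 (eq_one_of_sq_of_cube h hq)
  by_cases h3 : ∃ a : G ⧸ H, a ^ 3 = 1 ∧ a ≠ 1
  · obtain ⟨a, ha, ha1⟩ := h3
    refine Or.inr (Or.inr (Or.inl ⟨isCyclicOrDihedral_of_order_three ha ha1 (fun b hb hb1 => ?_)
      hord', card_le_three_of_order_three h ha ha1⟩))
    by_contra! hn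
    obtain ⟨c, hc, hc1, h5, h6, h7, h8⟩ := exists_third_of_cube ha ha1 hb hb1 hn.1 hn.2
    rcases eq_or_eq_of_sq_ne_one h2 h (hsq ha ha1) (hsq hb hb1) (hsq hc hc1) hn.1 hn.2
      with h | h | h | h
    exacts [h5 h, h6 h, h7 h, h8 h]
  push Not at h3
  have hexp : ∀ q : G ⧸ H, q ^ 2 = 1 := fun q => by
    rcases hord' q with hq | hq
    · exact hq
    · rw [h3 q hq, one_pow]
  have hsingle : ∀ p : G ⧸ H, ∀ x ∈ ({p} : Set (G ⧸ H)), ∀ y ∈ ({p} : Set (G ⧸ H)),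
      PowerLinked x y := by
    rintro p _ rfl _ rfl; exact PowerLinked.refl _
  have hnt : Nontrivial (G ⧸ H) := Finite.one_lt_card_iff_nontrivial.1 hQ
  obtain ⟨p, hp⟩ := exists_ne (1 : G ⧸ H)
  have hp7 := ncard_mul_card_le (S := {p}) (fun h => hp h.symm) (hsingle p) h
  rw [Set.ncard_singleton, one_mul] at hp7
  by_cases hq : ∃ q : G ⧸ H, q ≠ 1 ∧ q ≠ p
  · obtain ⟨q, hq, hqp⟩ := hq
    refine Or.inr (Or.inl ⟨hexp, ?_⟩)
    by_contra hn
    have h1 : p ≠ p * q := fun hh => hq (mul_eq_left.1 hh.symm)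
    have h2 : q ≠ p * q := fun hh => hp (mul_eq_right.1 hh.symm)
    have h5 : p * q ≠ 1 := fun hh => hqp (by
      have := hexp p
      rw [pow_two] at this
      exact mul_left_cancel (hh.trans this.symm))
    have hfour : ∀ x : G ⧸ H, 4 ≤ ({x} : Set (G ⧸ H)).ncard * Nat.card H := fun x => by
      rw [Set.ncard_singleton]; omega
    have := three_le_of_embeds (S := {p}) (T := {q}) (U := {p * q}) (fun h => hp h.symm)
      (fun h => hq h.symm) (fun h => h5 h.symm) (hsingle _) (hsingle _) (hsingle _) (hfour _)
      (hfour _) (hfour _) (Set.disjoint_singleton.2 hqp.symm) (Set.disjoint_singleton.2 h1)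
      (Set.disjoint_singleton.2 h2) h
    omega
  · push Not at hq
    refine Or.inl ⟨?_, hp7⟩
    rw [Nat.card_eq_two_iff]
    refine ⟨1, p, hp.symm, Set.eq_univ_of_forall fun x => ?_⟩
    by_cases hx : x = 1
    · exact Or.inl hx
    · exact Or.inr (hq x hx)

end normalSubgroupPowerGraph

/-! ### The genus in each case -/

namespace SimpleGraph

theorem genus_eq_succ_iff {V : Type*} [Finite V] (Γ : SimpleGraph V) (g : ℕ) :
    Γ.genus = g + 1 ↔ Γ.EmbedsInSphereWithHandles (g + 1) ∧ ¬ Γ.EmbedsInSphereWithHandles g := by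
  constructor
  · intro h
    have hne : {g : ℕ | Γ.EmbedsInSphereWithHandles g}.Nonempty :=
      Nat.nonempty_of_pos_sInf (by rw [← genus, h]; exact Nat.succ_pos g)
    refine ⟨h ▸ Nat.sInf_mem hne, fun hg => ?_⟩
    have : Γ.genus ≤ g := Nat.sInf_le hg
    omega
  · rintro ⟨h1, h2⟩
    refine le_antisymm (Nat.sInf_le h1) (le_csInf ⟨_, h1⟩ fun b hb => ?_)
    by_contra hn
    exact h2 (EmbedsInSphereWithHandles.mono hb (by omega))

end SimpleGraph

section GroupTheory

variable {Q : Type*} [Group Q]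

theorem card_eq_two_iff_nonempty_mulEquiv :
    Nat.card Q = 2 ↔ Nonempty (Q ≃* Multiplicative (ZMod 2)) := by
  constructor
  · intro h
    have : Fact (Nat.Prime 2) := ⟨Nat.prime_two⟩
    have hc : IsCyclic Q := isCyclic_of_prime_card h
    exact ⟨(h ▸ zmodCyclicMulEquiv hc).symm⟩
  · rintro ⟨e⟩
    rw [Nat.card_congr e.toEquiv]
    exact Nat.card_zmod 2

theorem eq_or_eq_inv_of_mem_zpowers {a c : Q} (ha : a ^ 4 = 1) (hc : c ^ 2 ≠ 1)
    (h : c ∈ Subgroup.zpowers a) : c = a ∨ c = a⁻¹ := by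
  obtain ⟨m, hm⟩ := h
  have hm' : a ^ m = c := hm
  rcases zpow_cases ha m with h | h | h | h
  · exact absurd (by rw [← hm', h, one_pow]) hc
  · exact absurd (by rw [← hm', h, ← pow_mul]; exact ha) hc
  · exact Or.inl (hm'.symm.trans h)
  · exact Or.inr (hm'.symm.trans h)

theorem hasTwoCyclicFour_iff : normalSubgroupPowerGraph.HasTwoCyclicFour Q ↔
    IsPGroup 2 Q ∧ Monoid.exponent Q = 4 ∧
      {K : Subgroup Q | IsCyclic K ∧ Nat.card K = 4}.ncard = 2 := by
  have hset : ∀ K : Subgroup Q, K ∈ {K : Subgroup Q | IsCyclic K ∧ Nat.card K = 4} ↔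
      ∃ c : Q, c ^ 4 = 1 ∧ c ^ 2 ≠ 1 ∧ Subgroup.zpowers c = K := by
    intro K
    constructor
    · rintro ⟨hK, hcard⟩
      obtain ⟨c, rfl⟩ := Subgroup.isCyclic_iff_exists_zpowers_eq_top K |>.1 hK
      rw [Nat.card_zpowers] at hcard
      refine ⟨c, hcard ▸ pow_orderOf_eq_one c, fun h => ?_, rfl⟩
      have := Nat.le_of_dvd two_pos (orderOf_dvd_of_pow_eq_one h)
      omega
    · rintro ⟨c, hc, hc2, rfl⟩
      exact ⟨inferInstance, by rw [Nat.card_zpowers, orderOf_eq_four hc hc2]⟩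
  constructor
  · rintro ⟨a, b, ha, ha2, hb, hb2, hba, hba', hall⟩
    have hinv : ∀ {x : Q}, x ^ 4 = 1 → x⁻¹ ^ 4 = 1 := fun hx => by rw [inv_pow, hx, inv_one]
    have h4 : ∀ c : Q, c ^ 4 = 1 := fun c => by
      by_cases hc : c ^ 2 = 1
      · rw [show 4 = 2 * 2 from rfl, pow_mul, hc, one_pow]
      · rcases hall c hc with rfl | rfl | rfl | rfl
        exacts [ha, hinv ha, hb, hinv hb]
    refine ⟨fun c => ⟨2, h4 c⟩, Nat.dvd_antisymm (Monoid.exponent_dvd_of_forall_pow_eq_one h4)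
      (orderOf_eq_four ha ha2 ▸ Monoid.order_dvd_exponent a), Set.ncard_eq_two.2
      ⟨Subgroup.zpowers a, Subgroup.zpowers b, fun h => ?_, Set.ext fun K => ?_⟩⟩
    · rcases eq_or_eq_inv_of_mem_zpowers ha hb2 (h ▸ Subgroup.mem_zpowers b) with h | h
      exacts [hba h, hba' h]
    · rw [hset]
      constructor
      · rintro ⟨c, -, hc, rfl⟩
        rcases hall c hc with rfl | rfl | rfl | rfl
        · exact Or.inl rfl
        · exact Or.inl Subgroup.zpowers_inv
        · exact Or.inr rfl
        · exact Or.inr Subgroup.zpowers_inv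
      · rintro (rfl | rfl)
        exacts [⟨a, ha, ha2, rfl⟩, ⟨b, hb, hb2, rfl⟩]
  · rintro ⟨-, hexp, hcard⟩
    obtain ⟨K, L, hKL, hS⟩ := Set.ncard_eq_two.1 hcard
    obtain ⟨a, ha, ha2, rfl⟩ := (hset K).1 (hS ▸ Or.inl rfl)
    obtain ⟨b, hb, hb2, rfl⟩ := (hset L).1 (hS ▸ Or.inr rfl)
    refine ⟨a, b, ha, ha2, hb, hb2, fun h => hKL (by rw [h]),
      fun h => hKL (by rw [h, Subgroup.zpowers_inv]), fun c hc => ?_⟩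
    have hc4 : c ^ 4 = 1 := hexp ▸ Monoid.pow_exponent_eq_one c
    have hmem := (hset _).2 ⟨c, hc4, hc, rfl⟩
    rw [hS] at hmem
    rcases hmem with h | h
    · rcases eq_or_eq_inv_of_mem_zpowers ha hc (h ▸ Subgroup.mem_zpowers c) with h | h
      exacts [Or.inl h, Or.inr (Or.inl h)]
    · have h' : Subgroup.zpowers c = Subgroup.zpowers b := h
      rcases eq_or_eq_inv_of_mem_zpowers hb hc (h' ▸ Subgroup.mem_zpowers c) with h | h
      exacts [Or.inr (Or.inr (Or.inl h)), Or.inr (Or.inr (Or.inr h))]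

end GroupTheory

namespace normalSubgroupPowerGraph

variable {G : Type*} [Group G] {H : Subgroup G} [H.Normal] [Finite G]

theorem embeds_of_embeds_block (hcard : Nat.card H ≤ 3) {S : Set (G ⧸ H)} (hS : 1 ∉ S)
    (hiso : ∀ q ∉ S, q ≠ 1 → ∀ p, PowerLinked p q → p = 1 ∨ p = q) {g : ℕ}
    (h : (block H S).EmbedsInSphereWithHandles g) :
    (normalSubgroupPowerGraph H).EmbedsInSphereWithHandles g := by
  rw [← block_eq_of_forall (S := S ∪ {q | q ∉ S ∧ q ≠ 1})
    fun q hq => (em (q ∈ S)).imp_right fun h => ⟨h, hq⟩]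
  exact embeds_block_union_of_isolated hcard (fun q hq => ⟨hq.2, hiso q hq.1 hq.2⟩) hS h

theorem embeds_of_card_eq_two (hQ : Nat.card (G ⧸ H) = 2) {n g : ℕ} (hn : Nat.card H ≤ n)
    (h : (⊤ : SimpleGraph (Fin (n + 1))).EmbedsInSphereWithHandles g) :
    (normalSubgroupPowerGraph H).EmbedsInSphereWithHandles g := by
  obtain ⟨p, hp, hall⟩ := (Nat.card_eq_two_iff' (1 : G ⧸ H)).1 hQ
  rw [← block_eq_of_forall (S := {p}) fun q hq => hall q hq]
  exact embeds_block_of_embeds_completeGraph (fun h => hp h.symm)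
    (by rwa [Set.ncard_singleton, one_mul]) h

theorem le_of_card_eq_two (hQ : Nat.card (G ⧸ H) = 2) {n g : ℕ} (hn : n ≤ Nat.card H) (hn2 : 2 ≤ n)
    (h : (normalSubgroupPowerGraph H).EmbedsInSphereWithHandles g) :
    (n + 1).choose 2 + 6 ≤ 3 * (n + 1) + 6 * g := by
  obtain ⟨p, hp, -⟩ := (Nat.card_eq_two_iff' (1 : G ⧸ H)).1 hQ
  refine choose_le_of_completeGraph (by omega) (embeds_completeGraph_of_embeds_block (S := {p})
    (fun h => hp h.symm) ?_ (by rwa [Set.ncard_singleton, one_mul]) (embeds_block_of_embeds h _))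
  rintro _ rfl _ rfl
  exact PowerLinked.refl _

theorem embeds_zero_of_exponent_two (hQ : ∀ q : G ⧸ H, q ^ 2 = 1) (hcard : Nat.card H ≤ 3) :
    (normalSubgroupPowerGraph H).EmbedsInSphereWithHandles 0 := by
  refine embeds_of_embeds_block hcard (Set.notMem_empty 1) (fun q _ hq1 p hp => ?_)
    (embeds_block_of_embeds_completeGraph (n := 3) (Set.notMem_empty 1) (by simp)
      completeGraph_four_embeds)
  exact eq_one_or_eq_of_powerLinked (hQ q) hq1 (fun _ => hQ p) hp

theorem embeds_one_of_isCyclicOrDihedral {n : ℕ} (hQ : IsCyclicOrDihedral n (G ⧸ H))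
    (hcard : Nat.card H ≤ 3) (hn : (n - 1) * Nat.card H ≤ 6) :
    (normalSubgroupPowerGraph H).EmbedsInSphereWithHandles 1 := by
  obtain ⟨a, ha, hall⟩ := hQ
  have h1 : (1 : G ⧸ H) ∉ (Subgroup.zpowers a : Set (G ⧸ H)) \ {1} := fun h => h.2 rfl
  refine embeds_of_embeds_block hcard h1 (fun q hq hq1 p hp => ?_)
    (embeds_block_of_embeds_completeGraph (n := 6) h1 ?_ completeGraph_seven_embeds)
  · have hqa : q ∉ Subgroup.zpowers a := fun h => hq ⟨h, hq1⟩
    refine eq_one_or_eq_of_powerLinked (hall q hqa).1 hq1 ?_ hp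
    rintro ⟨m, rfl⟩
    exact (hall p fun h => hqa (zpow_mem h m)).1
  · rwa [Set.ncard_sdiff_singleton_of_mem (one_mem (Subgroup.zpowers a)), ← Nat.card_coe_set_eq,
      SetLike.coe_sort_coe, Nat.card_zpowers, ha]

theorem not_embeds_zero_of_isCyclicOrDihedral (h2 : 2 ≤ Nat.card H) {n : ℕ} (hn : 3 ≤ n)
    (hQ : IsCyclicOrDihedral n (G ⧸ H)) :
    ¬ (normalSubgroupPowerGraph H).EmbedsInSphereWithHandles 0 := by
  intro h
  obtain ⟨a, ha, -⟩ := hQ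
  have ha2 : a ^ 2 ≠ 1 := fun h => by
    have := Nat.le_of_dvd two_pos (orderOf_dvd_of_pow_eq_one h)
    omega
  have := one_le_of_embeds_block (one_notMem_pair (ne_one_of_sq_ne_one ha2))
    (powerLinked_of_mem_pair a) (four_le_ncard_pair h2 ha2) (embeds_block_of_embeds h _)
  omega

theorem not_embeds_one_of_hasTwoCyclicFour (h2 : 2 ≤ Nat.card H) (hQ : HasTwoCyclicFour (G ⧸ H)) :
    ¬ (normalSubgroupPowerGraph H).EmbedsInSphereWithHandles 1 := by
  intro h
  obtain ⟨a, b, -, ha2, -, hb2, hba, hba', -⟩ := hQ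
  have := two_le_of_embeds (one_notMem_pair (ne_one_of_sq_ne_one ha2))
    (one_notMem_pair (ne_one_of_sq_ne_one hb2)) (powerLinked_of_mem_pair a)
    (powerLinked_of_mem_pair b) (four_le_ncard_pair h2 ha2) (four_le_ncard_pair h2 hb2)
    (disjoint_pair hba hba') (embeds_block_of_embeds h _)
  omega

/-- An element of `{a, a⁻¹}` and one of `{b, b⁻¹}` are not powers of one another if they have order
`4` and generate different subgroups. -/
theorem not_powerLinked_of_mem_pair {Q : Type*} [Group Q] {a b : Q} (ha : a ^ 4 = 1)
    (ha2 : a ^ 2 ≠ 1) (hb : b ^ 4 = 1) (hb2 : b ^ 2 ≠ 1) (hba : b ≠ a) (hba' : b ≠ a⁻¹)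
    {p q : Q} (hp : p ∈ ({a, a⁻¹} : Set Q)) (hq : q ∈ ({b, b⁻¹} : Set Q)) : ¬ PowerLinked p q := by
  have h4 : ∀ {x y : Q}, x ^ 4 = 1 → y ∈ ({x, x⁻¹} : Set Q) → y ^ 4 = 1 := by
    rintro x y hx (rfl | rfl)
    · exact hx
    · rw [inv_pow, hx, inv_one]
  have h2 : ∀ {x y : Q}, x ^ 2 ≠ 1 → y ∈ ({x, x⁻¹} : Set Q) → y ^ 2 ≠ 1 := by
    rintro x y hx (rfl | rfl)
    · exact hx
    · rw [inv_pow, ne_eq, inv_eq_one]; exact hx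
  have hdis := Set.disjoint_left.1 (disjoint_pair hba hba') hp
  have hpq : p ≠ q := fun h => hdis (h ▸ hq)
  have hpq' : p ≠ q⁻¹ := fun h => hdis (by
    rcases hq with rfl | rfl
    · exact Or.inr h
    · exact Or.inl (h.trans (inv_inv _)))
  rintro (⟨m, hm⟩ | ⟨m, hm⟩)
  · rcases eq_or_eq_inv_of_mem_zpowers (h4 hb hq) (h2 ha2 hp) ⟨m, hm.symm⟩ with h | h
    exacts [hpq h, hpq' h]
  · rcases eq_or_eq_inv_of_mem_zpowers (h4 ha hp) (h2 hb2 hq) ⟨m, hm.symm⟩ with h | h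
    exacts [hpq h.symm, hpq' (inv_eq_iff_eq_inv.1 h.symm)]

theorem embeds_two_of_hasTwoCyclicFour (h2 : Nat.card H = 2) (hQ : HasTwoCyclicFour (G ⧸ H)) :
    (normalSubgroupPowerGraph H).EmbedsInSphereWithHandles 2 := by
  classical
  obtain ⟨a, b, ha, ha2, hb, hb2, hba, hba', hall⟩ := hQ
  have hab : a ^ 2 = b ^ 2 := sq_eq_sq_of_order_four ha ha2 hb hb2 fun c _ hc => hall c hc
  let gen : Fin 2 → G ⧸ H := ![a, b]
  let S : Set (G ⧸ H) := {a ^ 2} ∪ ({a, a⁻¹} ∪ {b, b⁻¹})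
  have hgen2 : ∀ i, gen i ^ 2 ≠ 1 := by
    intro i; fin_cases i
    exacts [ha2, hb2]
  have hS : 1 ∉ S := by
    rintro (h | h | h)
    · exact ha2 h.symm
    · exact one_notMem_pair (ne_one_of_sq_ne_one ha2) h
    · exact one_notMem_pair (ne_one_of_sq_ne_one hb2) h
  refine embeds_of_embeds_block (by omega) hS (fun q hq hq1 p hp => ?_) ?_
  · have hq2 : q ^ 2 = 1 := by
      by_contra h
      apply hq
      rcases hall q h with h | h | h | h
      · exact Or.inr (Or.inl (Or.inl h))
      · exact Or.inr (Or.inl (Or.inr h))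
      · exact Or.inr (Or.inr (Or.inl h))
      · exact Or.inr (Or.inr (Or.inr h))
    refine eq_one_or_eq_of_powerLinked hq2 hq1 ?_ hp
    rintro ⟨m, rfl⟩
    by_contra hp2
    have hp4 : p ^ 4 = 1 ∧ p ^ 2 = a ^ 2 := by
      have hinv : ∀ {x : G ⧸ H}, x ^ 4 = 1 → x⁻¹ ^ 4 = 1 ∧ x⁻¹ ^ 2 = x ^ 2 := fun {x} hx =>
        ⟨by rw [inv_pow, hx, inv_one], by rw [inv_pow, inv_eq_iff_mul_eq_one, ← pow_add]; exact hx⟩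
      rcases hall p hp2 with rfl | rfl | rfl | rfl
      exacts [⟨ha, rfl⟩, hinv ha, ⟨hb, hab.symm⟩, ⟨(hinv hb).1, (hinv hb).2.trans hab.symm⟩]
    rcases zpow_cases hp4.1 m with h | h | h | h
    · exact hq1 h
    · exact hq (Or.inl (h.trans hp4.2))
    · rw [h] at hq2; exact hp2 hq2
    · rw [h, inv_pow, inv_eq_one] at hq2; exact hp2 hq2
  · have hc1 : Nat.card {x : {x : G // x ∉ H ∨ x = 1} // coset x ∈ ({a ^ 2} : Set (G ⧸ H))} = 2 := by
      rw [card_fiber fun h => ha2 h.symm, h2, Set.ncard_singleton]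
    have hc2 : ∀ i, Nat.card {x : {x : G // x ∉ H ∨ x = 1} //
        coset x ∈ ({gen i, (gen i)⁻¹} : Set (G ⧸ H))} = 4 := by
      intro i
      rw [card_fiber (one_notMem_pair (ne_one_of_sq_ne_one (hgen2 i))), h2, Set.ncard_pair fun h =>
        hgen2 i (by rw [pow_two]; exact mul_eq_one_iff_eq_inv.2 h)]
    let ε := Finite.equivFinOfCardEq hc1
    let δ := fun i => Finite.equivFinOfCardEq (hc2 i)
    let F : {x : G // x ∉ H ∨ x = 1} → Fin 3 ⊕ Fin 2 × Fin 4 := fun x =>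
      if h : coset x ∈ ({a ^ 2} : Set (G ⧸ H)) then Sum.inl (ε ⟨x, h⟩).succ
      else if h : coset x ∈ ({gen 0, (gen 0)⁻¹} : Set (G ⧸ H)) then Sum.inr (0, δ 0 ⟨x, h⟩)
      else if h : coset x ∈ ({gen 1, (gen 1)⁻¹} : Set (G ⧸ H)) then Sum.inr (1, δ 1 ⟨x, h⟩)
      else Sum.inl 0
    -- What the value of `F` at a vertex of the block says about its coset.
    have hF : ∀ x, coset x ∈ S ∨ coset x = 1 →
        (F x = Sum.inl 0 ∧ x = base H) ∨
        (∃ h : coset x ∈ ({a ^ 2} : Set (G ⧸ H)), F x = Sum.inl (ε ⟨x, h⟩).succ) ∨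
        ∃ (i : Fin 2) (h : coset x ∈ ({gen i, (gen i)⁻¹} : Set (G ⧸ H))),
          F x = Sum.inr (i, δ i ⟨x, h⟩) := by
      intro x hx
      by_cases h1 : coset x ∈ ({a ^ 2} : Set (G ⧸ H))
      · exact Or.inr (Or.inl ⟨h1, by simp only [F, dif_pos h1]⟩)
      by_cases h3 : coset x ∈ ({gen 0, (gen 0)⁻¹} : Set (G ⧸ H))
      · exact Or.inr (Or.inr ⟨0, h3, by simp only [F, dif_neg h1, dif_pos h3]⟩)
      by_cases h4 : coset x ∈ ({gen 1, (gen 1)⁻¹} : Set (G ⧸ H))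
      · exact Or.inr (Or.inr ⟨1, h4, by simp only [F, dif_neg h1, dif_neg h3, dif_pos h4]⟩)
      refine Or.inl ⟨by simp only [F, dif_neg h1, dif_neg h3, dif_neg h4], coset_eq_one_iff.1 ?_⟩
      refine hx.resolve_left ?_
      rintro (h | h | h)
      exacts [h1 h, h3 h, h4 h]
    have hinj : Set.InjOn F (block H S).support := by
      rintro x ⟨x', hx⟩ y ⟨y', hy⟩ hxy
      rcases hF x hx.2.1 with ⟨h, hx1⟩ | ⟨hx1, h⟩ | ⟨i, hx1, h⟩ <;>
      rcases hF y hy.2.1 with ⟨k, hy1⟩ | ⟨hy1, k⟩ | ⟨j, hy1, k⟩ <;> rw [h, k] at hxy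
      · rw [hx1, hy1]
      · exact absurd (Sum.inl_injective hxy).symm (Fin.succ_ne_zero _)
      · cases hxy
      · exact absurd (Sum.inl_injective hxy) (Fin.succ_ne_zero _)
      · exact congrArg Subtype.val (ε.injective (Fin.succ_injective _ (Sum.inl_injective hxy)))
      · cases hxy
      · cases hxy
      · cases hxy
      · have h5 := Sum.inr_injective hxy
        obtain rfl : i = j := congrArg Prod.fst h5
        exact congrArg Subtype.val ((δ i).injective (congrArg Prod.snd h5))
    refine doubleSeven_embeds.of_injOn F (fun x y hxy => ?_) hinj
    rw [doubleSeven, fromRel_adj]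
    refine ⟨fun h => hxy.ne (hinj ⟨y, hxy⟩ ⟨x, hxy.symm⟩ h), Or.inl fun u v hu hv => ?_⟩
    have hlink := (adj_iff.1 hxy.1).2
    rcases hF x hxy.2.1 with ⟨h, -⟩ | ⟨_, h⟩ | ⟨i, hx1, h⟩
    · rw [h] at hu; cases hu
    · rw [h] at hu; cases hu
    rcases hF y hxy.2.2 with ⟨k, -⟩ | ⟨_, k⟩ | ⟨j, hy1, k⟩
    · rw [k] at hv; cases hv
    · rw [k] at hv; cases hv
    rw [h] at hu
    rw [k] at hv
    rw [← Sum.inr_injective hu, ← Sum.inr_injective hv]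
    change i = j
    fin_cases i <;> fin_cases j
    · rfl
    · exact absurd hlink (not_powerLinked_of_mem_pair ha ha2 hb hb2 hba hba' hx1 hy1)
    · exact absurd hlink.symm (not_powerLinked_of_mem_pair ha ha2 hb hb2 hba hba' hy1 hx1)
    · rfl

end normalSubgroupPowerGraph

open normalSubgroupPowerGraph in
theorem theorem1p1 {G : Type*} [Group G] [Finite G] (H : Subgroup G) [H.Normal]
    (hH_nontrivial : H ≠ ⊥) (hH_proper : H ≠ ⊤) :
    ((normalSubgroupPowerGraph H).genus = 1 ↔
      ((Nat.card H = 4 ∨ Nat.card H = 5 ∨ Nat.card H = 6) ∧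
          Nonempty (G ⧸ H ≃* Multiplicative (ZMod 2))) ∨
      (Nat.card H = 3 ∧
          (Nonempty (G ⧸ H ≃* Multiplicative (ZMod 3)) ∨
           Nonempty (G ⧸ H ≃* Equiv.Perm (Fin 3)))) ∨
      (Nat.card H = 2 ∧
          (Nonempty (G ⧸ H ≃* Multiplicative (ZMod 3)) ∨
           Nonempty (G ⧸ H ≃* Equiv.Perm (Fin 3)) ∨
           Nonempty (G ⧸ H ≃* DihedralGroup 4) ∨
           Nonempty (G ⧸ H ≃* Multiplicative (ZMod 4))))) ∧
    ((normalSubgroupPowerGraph H).genus = 2 ↔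
      (Nat.card H = 7 ∧ Nonempty (G ⧸ H ≃* Multiplicative (ZMod 2))) ∨
      (Nat.card H = 2 ∧ IsPGroup 2 (G ⧸ H) ∧ Monoid.exponent (G ⧸ H) = 4 ∧
          {K : Subgroup (G ⧸ H) | IsCyclic K ∧ Nat.card K = 4}.ncard = 2)) := by
  have h2 : 2 ≤ Nat.card H := H.one_lt_card_iff_ne_bot.2 hH_nontrivial
  have hQ : 2 ≤ Nat.card (G ⧸ H) := by
    have h1 : H.index ≠ 1 := fun h => hH_proper (Subgroup.index_eq_one.1 h)
    have h0 : H.index ≠ 0 := Subgroup.index_ne_zero_of_finite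
    change 2 ≤ H.index
    omega
  have hS3 : Nonempty (G ⧸ H ≃* Equiv.Perm (Fin 3)) ↔ Nonempty (G ⧸ H ≃* DihedralGroup 3) := by
    obtain ⟨e⟩ := nonempty_perm_mulEquiv_dihedralGroup
    exact ⟨fun ⟨f⟩ => ⟨f.trans e⟩, fun ⟨f⟩ => ⟨f.trans e.symm⟩⟩
  rw [hS3, or_comm (a := Nonempty (G ⧸ H ≃* DihedralGroup 4)), ← or_assoc (c := _ ∨ _),
    ← isCyclicOrDihedral_iff le_rfl, ← isCyclicOrDihedral_iff (by norm_num),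
    ← hasTwoCyclicFour_iff, ← card_eq_two_iff_nonempty_mulEquiv, genus_eq_succ_iff _ 0,
    genus_eq_succ_iff _ 1, zero_add, one_add_one_eq_two]
  constructor
  · constructor
    · rintro ⟨h1, h0⟩
      rcases classification h2 (h1.mono one_le_two) hQ with ⟨hc, h⟩ | ⟨hc, h⟩ | ⟨hc, h⟩ | ⟨hc, h⟩ |
        ⟨hc, h⟩
      · have h4 : ¬ Nat.card H ≤ 3 := fun h3 =>
          h0 (embeds_of_card_eq_two hc h3 completeGraph_four_embeds)
        have h7 : ¬ 7 ≤ Nat.card H := fun h7 => by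
          have := le_of_card_eq_two hc h7 (by norm_num) h1
          simp [Nat.choose] at this
        exact Or.inl ⟨by omega, hc⟩
      · exact absurd (embeds_zero_of_exponent_two hc h) h0
      · by_cases h3 : Nat.card H = 3
        · exact Or.inr (Or.inl ⟨h3, hc⟩)
        · exact Or.inr (Or.inr ⟨by omega, Or.inl hc⟩)
      · exact Or.inr (Or.inr ⟨h, Or.inr hc⟩)
      · exact absurd h1 (not_embeds_one_of_hasTwoCyclicFour h2 hc)
    · rintro (⟨h, hc⟩ | ⟨h, hc⟩ | ⟨h, hc | hc⟩)
      · refine ⟨embeds_of_card_eq_two (n := 6) hc (by omega) completeGraph_seven_embeds, fun h0 => ?_⟩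
        have := le_of_card_eq_two (n := 4) hc (by omega) (by norm_num) h0
        simp [Nat.choose] at this
      · exact ⟨embeds_one_of_isCyclicOrDihedral hc (by omega) (by omega),
          not_embeds_zero_of_isCyclicOrDihedral h2 le_rfl hc⟩
      · exact ⟨embeds_one_of_isCyclicOrDihedral hc (by omega) (by omega),
          not_embeds_zero_of_isCyclicOrDihedral h2 le_rfl hc⟩
      · exact ⟨embeds_one_of_isCyclicOrDihedral hc (by omega) (by omega),
          not_embeds_zero_of_isCyclicOrDihedral h2 (by norm_num) hc⟩
  · constructor
    · rintro ⟨h1, h0⟩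
      rcases classification h2 h1 hQ with ⟨hc, h⟩ | ⟨hc, h⟩ | ⟨hc, h⟩ | ⟨hc, h⟩ | ⟨hc, h⟩
      · have h6 : ¬ Nat.card H ≤ 6 := fun h6 =>
          h0 (embeds_of_card_eq_two hc h6 completeGraph_seven_embeds)
        exact Or.inl ⟨by omega, hc⟩
      · exact absurd ((embeds_zero_of_exponent_two hc h).mono zero_le_one) h0
      · exact absurd (embeds_one_of_isCyclicOrDihedral hc h (by omega)) h0
      · exact absurd (embeds_one_of_isCyclicOrDihedral hc (by omega) (by omega)) h0
      · exact Or.inr ⟨h, hc⟩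
    · rintro (⟨h, hc⟩ | ⟨h, hc⟩)
      · refine ⟨embeds_of_card_eq_two hc h.le completeGraph_eight_embeds, fun h1 => ?_⟩
        have := le_of_card_eq_two hc h.ge (by norm_num) h1
        simp [Nat.choose] at this
      · exact ⟨embeds_two_of_hasTwoCyclicFour h hc, not_embeds_one_of_hasTwoCyclicFour h2 hc⟩
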